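/- Let $\mathcal{C}$ be a model category (finite limits and colimits, two-out-of-three, retracts, lifting, and not necessarily functorial factorizations) and let $\mathcal{Q}$ be a poset. For a monotone map $\alpha\colon\mathcal{D}\to\mathcal{Q}$ with $\mathcal{D}$ a finite poset, a functor $X\colon\mathcal{Q}\to\mathcal{C}$ is *discretized* by $\alpha$ if $X$ is isomorphic to the left Kan extension along $\alpha$ of some functor $\mathcal{D}\to\mathcal{C}$; $X$ is *tame* if it is discretized by some such $\alpha$, and $\mathrm{Tame}(\mathcal{Q},\mathcal{C})\subset\mathrm{Fun}(\mathcal{Q},\mathcal{C})$ denotes the full subcategory of tame functors. The map $\alpha$ *admits a transfer* if the induced map $\alpha_*\colon\mathcal{D}\cup\{-\infty\}\to\mathcal{Q}\cup\{-\infty\}$ (a new global minimum is added to both posets and preserved) has a monotone right adjoint. For $\mathcal{D}$ a finite poset, a morphism $\varphi\colon X\to Y$ in $\mathrm{Fun}(\mathcal{D},\mathcal{C})$ is a *projective cofibration* if for every $x\in\mathcal{D}$ the mediating morphism $$\mathrm{colim}\bigl(\mathrm{colim}_{d<x}Y(d)\leftarrow \mathrm{colim}_{d<x}X(d)\to X(x)\bigr)\to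 Y(x)$$ is a cofibration in $\mathcal{C}$. A model category satisfies the *minimal cofibrant factorization axiom* if every morphism $f\colon X\to Y$ factors as $f=\pi c$ with $c\colon X\to W$ a cofibration and $\pi\colon W\to Y$ both a fibration and a weak equivalence, such that every $\psi\colon W\to W$ with $\psi c=c$ and $\pi\psi=\pi$ is an isomorphism. Assume that every tame functor $\mathcal{Q}\to\mathcal{C}$ is discretized by some monotone map from a finite poset that admits a transfer. Assume moreover that $\mathcal{C}$ has a zero object or that there is a finite subset $S\subset\mathcal{Q}$ such that every element of $\mathcal{Q}$ is greater than or equal to some element of $S$. Then the following classes of morphisms define a model structure on $\mathrm{Tame}(\mathcal{Q},\mathcal{C})$. A morphism $\varphi\colon X\to Y$ is - a weak equivalence (respectively, a fibration) if $\varphi(x)\colon X(x)\to Y(x)$ is a weak equivalence (respectively, a fibration) in $\mathcal{C}$ for every $x\in\mathcal{Q}$; - a cofibration if there is a finite full subposet $\mathcal{D}\subset\mathcal{Q}$ whose inclusion discretizes both $X$ and $Y$ and such that the restriction of $\varphi$ to $\mathcal{D}$ is a projective cofibration in $\mathrm{Fun}(\mathcal{D},\mathcal{C})$. Furthermore, if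 $\mathcal{C}$ satisfies the minimal cofibrant factorization axiom, then so does $\mathrm{Tame}(\mathcal{Q},\mathcal{C})$ with this model structure. -/

import Mathlib

open CategoryTheory Limits HomotopicalAlgebra

universe w w' v u

namespace TameFunctors

section Tameness

variable {Q : Type w} [PartialOrder Q] {D : Type w'} [PartialOrder D]
  {C : Type u} [Category.{v} C]

/-- A monotone map `α : D → Q` admits a transfer if the induced map `α_* : D_* → Q_*`, where `D_*`
and `Q_*` are obtained by adjoining a global minimum `-∞`, has a (monotone) right adjoint. -/
def AdmitsTransfer (α : D →o Q) : Prop :=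
  ∃ t : WithBot Q →o WithBot D, GaloisConnection α.withBotMap t

/-- `X : Q ⥤ C` is discretized by `α : D → Q` if `X` is (isomorphic to) the left Kan extension
along `α` of some functor `Y : D ⥤ C`. -/
def Discretizes (α : D →o Q) (X : Q ⥤ C) : Prop :=
  ∃ (Y : D ⥤ C) (η : Y ⟶ α.monotone.functor ⋙ X), X.IsLeftKanExtension η

variable (Q C) in
/-- `X : Q ⥤ C` is tame if it is discretized by some monotone map from a finite poset. -/
def isTame : ObjectProperty (Q ⥤ C) := fun X ↦
  ∃ (D : Type w) (_ : PartialOrder D) (_ : Finite D) (α : D →o Q), Discretizes α X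

variable (Q C) in
/-- The full subcategory of tame functors in `Q ⥤ C`. -/
abbrev Tame : Type _ := (isTame Q C).FullSubcategory

/-- The inclusion of a finite full subposet. -/
abbrev finiteInclusion (S : Finset Q) : {q : Q // q ∈ S} →o Q := OrderHom.Subtype.val (· ∈ S)

end Tameness

section ProjectiveCofibrations

variable {D : Type w} [PartialOrder D] [Finite D] {C : Type u} [Category.{v} C]

instance hasColimitsOfShape_of_finite_poset [HasFiniteColimits C] : HasColimitsOfShape D C := by
  have : Fintype D := Fintype.ofFinite D
  exact hasColimitsOfShape_of_hasFiniteColimits C D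

variable [HasFiniteColimits C]

/-- The inclusion of `{d | d < x}` into `D`. -/
abbrev belowIncl (x : D) : Set.Iio x ⥤ D := (Subtype.mono_coe (· ∈ Set.Iio x)).functor

/-- The colimit of `X` over `{d | d < x}`. -/
noncomputable abbrev colimBelow (X : D ⥤ C) (x : D) : C := colimit (belowIncl x ⋙ X)

/-- The cocone with point `X(x)` given by the maps `X(d) → X(x)` for `d < x`. -/
def coconeBelow (X : D ⥤ C) (x : D) : Cocone (belowIncl x ⋙ X) where
  pt := X.obj x
  ι :=
    { app := fun d ↦ X.map (homOfLE d.2.le)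
      naturality := fun d d' f ↦
        (X.map_comp ((belowIncl x).map f) (homOfLE d'.2.le)).symm.trans
          (Category.comp_id (X.map (homOfLE d.2.le))).symm }

/-- The morphism from the colimit of `X` over `{d | d < x}` to `X(x)`. -/
noncomputable def colimBelowTo (X : D ⥤ C) (x : D) : colimBelow X x ⟶ X.obj x :=
  colimit.desc (belowIncl x ⋙ X) (coconeBelow X x)

/-- The morphism induced by `φ` on colimits over `{d | d < x}`. -/
noncomputable def colimBelowMap {X Y : D ⥤ C} (φ : X ⟶ Y) (x : D) :
    colimBelow X x ⟶ colimBelow Y x :=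
  colimMap (Functor.whiskerLeft (belowIncl x) φ)

lemma colimBelow_comm {X Y : D ⥤ C} (φ : X ⟶ Y) (x : D) :
    colimBelowMap φ x ≫ colimBelowTo Y x = colimBelowTo X x ≫ φ.app x := by
  refine colimit.hom_ext fun d ↦ ?_
  have hY : colimit.ι (belowIncl x ⋙ Y) d ≫ colimBelowTo Y x = Y.map (homOfLE d.2.le) :=
    colimit.ι_desc (coconeBelow Y x) d
  have hX : colimit.ι (belowIncl x ⋙ X) d ≫ colimBelowTo X x = X.map (homOfLE d.2.le) :=
    colimit.ι_desc (coconeBelow X x) d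
  have hφ : colimit.ι (belowIncl x ⋙ X) d ≫ colimBelowMap φ x =
      (Functor.whiskerLeft (belowIncl x) φ).app d ≫ colimit.ι (belowIncl x ⋙ Y) d :=
    ι_colimMap (Functor.whiskerLeft (belowIncl x) φ) d
  rw [reassoc_of% hφ, reassoc_of% hX]
  exact (congrArg (φ.app d.1 ≫ ·) hY).trans (φ.naturality _).symm

/-- The mediating morphism from the pushout of
`colim_{d < x} Y(d) ← colim_{d < x} X(d) → X(x)` to `Y(x)`. -/
noncomputable def mediating {X Y : D ⥤ C} (φ : X ⟶ Y) (x : D) :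
    pushout (colimBelowMap φ x) (colimBelowTo X x) ⟶ Y.obj x :=
  pushout.desc (colimBelowTo Y x) (φ.app x) (colimBelow_comm φ x)

/-- The projective cofibrations in `D ⥤ C`, for `D` a finite poset. -/
def projectiveCofibrations [CategoryWithCofibrations C] : MorphismProperty (D ⥤ C) :=
  fun _ _ φ ↦ ∀ x : D, Cofibration (mediating φ x)

end ProjectiveCofibrations

section ModelStructure

variable (Q : Type w) [PartialOrder Q] (C : Type u) [Category.{v} C] [ModelCategory C]

/-- Objectwise weak equivalences between tame functors. -/
def tameWeakEquivalences : MorphismProperty (Tame Q C) :=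
  fun _ _ φ ↦ ∀ x : Q, WeakEquivalence (φ.hom.app x)

/-- Objectwise fibrations between tame functors. -/
def tameFibrations : MorphismProperty (Tame Q C) :=
  fun _ _ φ ↦ ∀ x : Q, Fibration (φ.hom.app x)

/-- Morphisms of tame functors whose restriction to some finite full subposet, discretizing both
the source and the target, is a projective cofibration. -/
def tameCofibrations : MorphismProperty (Tame Q C) :=
  fun X Y φ ↦ ∃ S : Finset Q,
    Discretizes (finiteInclusion S) X.obj ∧ Discretizes (finiteInclusion S) Y.obj ∧
      projectiveCofibrations (Functor.whiskerLeft (finiteInclusion S).monotone.functor φ.hom)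

end ModelStructure

section Minimality

variable {C : Type u} [Category.{v} C]

/-- The factorization `c ≫ p` is minimal if every endomorphism of it is an isomorphism. -/
def IsMinimalFactorization {X W Y : C} (c : X ⟶ W) (p : W ⟶ Y) : Prop :=
  ∀ φ : W ⟶ W, c ≫ φ = c → φ ≫ p = p → IsIso φ

variable (C) in
/-- Every morphism admits a minimal factorization as a cofibration followed by a fibration that is
a weak equivalence. -/
def MinimalCofibrantFactorizationAxiom [ModelCategory C] : Prop :=
  ∀ ⦃X Y : C⦄ (f : X ⟶ Y), ∃ (W : C) (c : X ⟶ W) (p : W ⟶ Y),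
    c ≫ p = f ∧ Cofibration c ∧ Fibration p ∧ WeakEquivalence p ∧ IsMinimalFactorization c p

end Minimality

end TameFunctors

open TameFunctors

/-!
For a finite poset `D`, a functor on `D` is determined by its values together with its latching
maps, so lifts and factorizations of a morphism of functors can be built one element of `D` at a
time, solving in `C` the corresponding problem for the mediating morphism. This turns every weak
factorization system `(L, R)` on `C` into one on `D ⥤ C`, whose left class is given by the mediating
morphisms and whose right class is objectwise, and it preserves minimality of factorizations.

Left Kan extension along a finite full subposet `S` of `Q` is fully faithful with right adjoint the
restriction, and its essential image consists of the functors discretized by `S`. Lifting problems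
against tame functors therefore reduce to `S`. So do factorizations, except that the extension of an
objectwise `R` morphism from `S` to `Q` need not be objectwise in `R`. It is when `S` has floors:
each value at `q` is then the value at the floor of `q`, or initial if `q` has no floor.

If `C` has two distinct parallel morphisms `A ⟶ Z`, then `S` can discretize the functor freely
generated by one copy of `A` at each point of `T` only if it contains `T`, so the hypothesis puts
every finite subset inside one with floors. Otherwise `C` is a preorder: factorizations can be
chosen objectwise, and the hypothesis, again applied to free functors, provides enough finiteness
in `Q` for the result to be tame.
-/

namespace TameFunctors

section Objectwise

variable {J : Type*} [Category* J] {C : Type u} [Category.{v} C]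

lemma llp_functorCategory_le [∀ a b : J, HasProductsOfShape (a ⟶ b) C] (R : MorphismProperty C)
    [∀ a b : J, R.IsStableUnderProductsOfShape (a ⟶ b)] :
    (R.functorCategory J).llp ≤ R.llp.functorCategory J := by
  intro X Y φ hφ j A B p hp
  refine ((evaluationAdjunctionLeft C j).hasLiftingProperty_iff φ p).2 (hφ _ fun k ↦ ?_)
  exact MorphismProperty.limitsOfShape_le _ <|
    MorphismProperty.limitsOfShape_limMap (W := R) (J := Discrete (k ⟶ j))
      (Discrete.natTrans (F := (Functor.const _).obj A) (G := (Functor.const _).obj B) fun _ ↦ p)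
      fun _ ↦ hp

end Objectwise

section LowerSets

lemma isLowerSet_induction {D : Type*} [PartialOrder D] [Finite D] {p : Set D → Prop}
    (empty : p ∅)
    (insert : ∀ (U : Set D) (x : D), IsLowerSet U → x ∉ U → Set.Iio x ⊆ U →
      p U → p (insert x U)) :
    p Set.univ := by
  obtain ⟨U, ⟨hU, hpU⟩, hmax⟩ :=
    (Set.toFinite {U : Set D | IsLowerSet U ∧ p U}).exists_maximal ⟨∅, isLowerSet_empty, empty⟩
  suffices h : Uᶜ = ∅ by rwa [Set.compl_empty_iff.1 h] at hpU
  by_contra hne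
  obtain ⟨x, hxU, hmin⟩ := (Set.toFinite Uᶜ).exists_minimal (Set.nonempty_iff_ne_empty.2 hne)
  have hbelow : Set.Iio x ⊆ U := fun d hd ↦ by
    by_contra hdU
    exact (hmin hdU hd.le).not_gt hd
  have hlow : IsLowerSet (Insert.insert x U) := by
    rintro a b hba (rfl | ha)
    · exact hba.eq_or_lt.imp id fun h ↦ hbelow h
    · exact Or.inr (hU hba ha)
  exact hxU (hmax ⟨hlow, insert U x hU hxU hbelow hpU⟩ (Set.subset_insert x U)
    (Set.mem_insert x U))

end LowerSets

section Latching

variable {D : Type w} [PartialOrder D] [Finite D] {C : Type u} [Category.{v} C]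
  [HasFiniteColimits C]

/-- The canonical morphism from `X(d)` to the colimit of `X` over the elements below `x`. -/
noncomputable def ιBelow (X : D ⥤ C) {d x : D} (h : d < x) : X.obj d ⟶ colimBelow X x :=
  colimit.ι (belowIncl x ⋙ X) ⟨d, h⟩

lemma colimBelow_hom_ext {X : D ⥤ C} {x : D} {Z : C} {f g : colimBelow X x ⟶ Z}
    (h : ∀ (d : D) (hd : d < x), ιBelow X hd ≫ f = ιBelow X hd ≫ g) : f = g :=
  colimit.hom_ext fun d ↦ h d.1 d.2

lemma map_ιBelow (X : D ⥤ C) {d d' x : D} (f : d ⟶ d') (h : d' < x) :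
    X.map f ≫ ιBelow X h = ιBelow X ((leOfHom f).trans_lt h) :=
  colimit.w (belowIncl x ⋙ X) (j := ⟨d', h⟩) (j' := ⟨d, (leOfHom f).trans_lt h⟩)
    (homOfLE (leOfHom f))

lemma ιBelow_colimBelowTo (X : D ⥤ C) {d x : D} (h : d < x) :
    ιBelow X h ≫ colimBelowTo X x = X.map (homOfLE h.le) :=
  colimit.ι_desc (coconeBelow X x) ⟨d, h⟩

lemma ιBelow_colimBelowMap {X Y : D ⥤ C} (φ : X ⟶ Y) {d x : D} (h : d < x) :
    ιBelow X h ≫ colimBelowMap φ x = φ.app d ≫ ιBelow Y h :=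
  ι_colimMap (Functor.whiskerLeft (belowIncl x) φ) ⟨d, h⟩

lemma exists_colimBelow_desc (X : D ⥤ C) (x : D) {Z : C} (k : ∀ d, d < x → (X.obj d ⟶ Z))
    (hk : ∀ (d d' : D) (f : d ⟶ d') (hd' : d' < x),
      X.map f ≫ k d' hd' = k d ((leOfHom f).trans_lt hd')) :
    ∃ l : colimBelow X x ⟶ Z, ∀ (d : D) (hd : d < x), ιBelow X hd ≫ l = k d hd :=
  let s : Cocone (belowIncl x ⋙ X) :=
    { pt := Z
      ι :=
        { app := fun d ↦ k d.1 d.2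
          naturality := fun d d' f ↦
            (hk d.1 d'.1 ((belowIncl x).map f) d'.2).trans (Category.comp_id _).symm } }
  ⟨colimit.desc _ s, fun d hd ↦ colimit.ι_desc s ⟨d, hd⟩⟩

/-- The source of `mediating φ x`. -/
noncomputable abbrev latch {X Y : D ⥤ C} (φ : X ⟶ Y) (x : D) : C :=
  pushout (colimBelowMap φ x) (colimBelowTo X x)

lemma inl_mediating {X Y : D ⥤ C} (φ : X ⟶ Y) (x : D) :
    pushout.inl _ _ ≫ mediating φ x = colimBelowTo Y x :=
  pushout.inl_desc _ _ _

lemma inr_mediating {X Y : D ⥤ C} (φ : X ⟶ Y) (x : D) :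
    pushout.inr _ _ ≫ mediating φ x = φ.app x :=
  pushout.inr_desc _ _ _

lemma latch_hom_ext {X Y : D ⥤ C} {φ : X ⟶ Y} {x : D} {Z : C} {f g : latch φ x ⟶ Z}
    (h₁ : ∀ (d : D) (hd : d < x), ιBelow Y hd ≫ pushout.inl _ _ ≫ f =
      ιBelow Y hd ≫ pushout.inl _ _ ≫ g)
    (h₂ : pushout.inr _ _ ≫ f = pushout.inr _ _ ≫ g) : f = g :=
  pushout.hom_ext (colimBelow_hom_ext h₁) h₂

section Functoriality

variable {X Y X' Y' : D ⥤ C} {φ : X ⟶ Y} {φ' : X' ⟶ Y'} {a : X ⟶ X'} {b : Y ⟶ Y'}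

/-- The morphism induced by a commutative square on the sources of the mediating morphisms. -/
noncomputable def latchMap (w : a ≫ φ' = φ ≫ b) (x : D) : latch φ x ⟶ latch φ' x :=
  pushout.map _ _ _ _ (colimBelowMap b x) (a.app x) (colimBelowMap a x)
    (colimBelow_hom_ext fun d hd ↦ by
      have wd : a.app d ≫ φ'.app d = φ.app d ≫ b.app d := NatTrans.congr_app w d
      rw [reassoc_of% ιBelow_colimBelowMap φ, ιBelow_colimBelowMap,
        reassoc_of% ιBelow_colimBelowMap a, ιBelow_colimBelowMap, reassoc_of% wd])
    (colimBelow_comm a x).symm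

lemma inl_latchMap (w : a ≫ φ' = φ ≫ b) (x : D) :
    pushout.inl _ _ ≫ latchMap w x = colimBelowMap b x ≫ pushout.inl _ _ :=
  pushout.inl_desc _ _ _

lemma inr_latchMap (w : a ≫ φ' = φ ≫ b) (x : D) :
    pushout.inr _ _ ≫ latchMap w x = a.app x ≫ pushout.inr _ _ :=
  pushout.inr_desc _ _ _

lemma latchMap_mediating (w : a ≫ φ' = φ ≫ b) (x : D) :
    latchMap w x ≫ mediating φ' x = mediating φ x ≫ b.app x := by
  refine pushout.hom_ext ?_ ?_
  · rw [reassoc_of% inl_latchMap, inl_mediating, reassoc_of% inl_mediating, colimBelow_comm]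
  · rw [reassoc_of% inr_latchMap, inr_mediating, reassoc_of% inr_mediating]
    exact NatTrans.congr_app w x

lemma isIso_colimBelowMap (φ : X ⟶ Y) (x : D) (h : ∀ d < x, IsIso (φ.app d)) :
    IsIso (colimBelowMap φ x) := by
  have : IsIso (Functor.whiskerLeft (belowIncl x) φ) :=
    (NatTrans.isIso_iff_isIso_app _).2 fun d ↦ h d.1 d.2
  exact inferInstanceAs (IsIso (colim.map (Functor.whiskerLeft (belowIncl x) φ)))

lemma isIso_latchMap (w : a ≫ φ' = φ ≫ b) (x : D) (ha : ∀ d ≤ x, IsIso (a.app d))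
    (hb : ∀ d < x, IsIso (b.app d)) : IsIso (latchMap w x) := by
  have := isIso_colimBelowMap a x fun d hd ↦ ha d hd.le
  have := isIso_colimBelowMap b x hb
  have := ha x le_rfl
  unfold latchMap
  infer_instance

end Functoriality

/-- The functor sending a morphism of diagrams to its mediating morphism at `x`. -/
@[simps]
noncomputable def mediatingFunctor (x : D) : Arrow (D ⥤ C) ⥤ Arrow C where
  obj φ := Arrow.mk (mediating φ.hom x)
  map h := Arrow.homMk (latchMap h.w x) (h.right.app x) (latchMap_mediating h.w x)
  map_id φ := by
    ext
    · refine latch_hom_ext (fun d hd ↦ ?_) ?_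
      · simp [inl_latchMap, reassoc_of% ιBelow_colimBelowMap]
      · simp [inr_latchMap]
    · simp
  map_comp h h' := by
    ext
    · refine latch_hom_ext (fun d hd ↦ ?_) ?_
      · simp [inl_latchMap, reassoc_of% inl_latchMap, reassoc_of% ιBelow_colimBelowMap]
      · simp [inr_latchMap, reassoc_of% inr_latchMap]
    · simp

/-- The morphisms of diagrams all of whose mediating morphisms lie in `L`. -/
def latching (L : MorphismProperty C) : MorphismProperty (D ⥤ C) :=
  fun _ _ φ ↦ ∀ x : D, L (mediating φ x)

instance (L : MorphismProperty C) [L.IsStableUnderRetracts] :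
    (latching L : MorphismProperty (D ⥤ C)).IsStableUnderRetracts where
  of_retract h hg x := L.of_retract (Retract.map h (mediatingFunctor x)) (hg x)

end Latching

section Lifting

variable {D : Type w} [PartialOrder D] {C : Type u} [Category.{v} C]
  {X Y A B : D ⥤ C} {φ : X ⟶ Y} {p : A ⟶ B} {a : X ⟶ A} {b : Y ⟶ B}

/-- A solution of the lifting problem `sq` on the elements of `U`. -/
structure PartialLift (sq : CommSq a φ p b) (U : Set D) where
  app (d : D) (hd : d ∈ U) : Y.obj d ⟶ A.obj d
  naturality {d d' : D} (f : d ⟶ d') (hd : d ∈ U) (hd' : d' ∈ U) :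
    Y.map f ≫ app d' hd' = app d hd ≫ A.map f
  fac_left (d : D) (hd : d ∈ U) : φ.app d ≫ app d hd = a.app d
  fac_right (d : D) (hd : d ∈ U) : app d hd ≫ p.app d = b.app d

namespace PartialLift

variable {sq : CommSq a φ p b} {U : Set D} {x : D}

lemma exists_value [Finite D] [HasFiniteColimits C] (l : PartialLift sq U) (hx : Set.Iio x ⊆ U)
    [HasLiftingProperty (mediating φ x) (p.app x)] :
    ∃ m : Y.obj x ⟶ A.obj x,
      (∀ (d : D) (f : d ⟶ x) (hd : d < x), Y.map f ≫ m = l.app d (hx hd) ≫ A.map f) ∧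
      φ.app x ≫ m = a.app x ∧ m ≫ p.app x = b.app x := by
  obtain ⟨s, hs⟩ := exists_colimBelow_desc Y x
    (fun d hd ↦ l.app d (hx hd) ≫ A.map (homOfLE hd.le)) fun d d' f hd' ↦ by
      rw [reassoc_of% l.naturality f (hx ((leOfHom f).trans_lt hd')) (hx hd'), ← A.map_comp]
      rfl
  have hsa : colimBelowMap φ x ≫ s = colimBelowTo X x ≫ a.app x := by
    refine colimBelow_hom_ext fun d hd ↦ ?_
    rw [reassoc_of% ιBelow_colimBelowMap, hs, reassoc_of% ιBelow_colimBelowTo,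
      reassoc_of% l.fac_left, a.naturality]
  have sqx : CommSq (pushout.desc s (a.app x) hsa) (mediating φ x) (p.app x) (b.app x) := by
    refine ⟨latch_hom_ext (fun d hd ↦ ?_) ?_⟩
    · rw [pushout.inl_desc_assoc, reassoc_of% hs d hd, p.naturality, reassoc_of% l.fac_right,
        reassoc_of% inl_mediating, reassoc_of% ιBelow_colimBelowTo, b.naturality]
    · rw [pushout.inr_desc_assoc, reassoc_of% inr_mediating]
      exact NatTrans.congr_app sq.w x
  refine ⟨sqx.lift, fun d f hd ↦ ?_, ?_, sqx.fac_right⟩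
  · obtain rfl : f = homOfLE hd.le := rfl
    rw [← ιBelow_colimBelowTo Y hd, ← inl_mediating φ, Category.assoc, Category.assoc,
      sqx.fac_left, pushout.inl_desc, hs]
  · rw [← inr_mediating, Category.assoc, sqx.fac_left, pushout.inr_desc]

open Classical in
/-- The extension of a partial solution on a lower set by a compatible value at a further
element. -/
noncomputable def insert (l : PartialLift sq U) (hU : IsLowerSet U) (hx : Set.Iio x ⊆ U)
    (m : Y.obj x ⟶ A.obj x)
    (hm : ∀ (d : D) (f : d ⟶ x) (hd : d < x), Y.map f ≫ m = l.app d (hx hd) ≫ A.map f)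
    (hleft : φ.app x ≫ m = a.app x) (hright : m ≫ p.app x = b.app x) :
    PartialLift sq (Insert.insert x U) :=
  have eq_x {d : D} (hd : d ∈ Insert.insert x U) (hdU : d ∉ U) : d = x := hd.resolve_right hdU
  { app := fun d hd ↦ if hdU : d ∈ U then l.app d hdU else
      Y.map (homOfLE (eq_x hd hdU).le) ≫ m ≫ A.map (homOfLE (eq_x hd hdU).ge)
    naturality := fun {d d'} f hd hd' ↦ by
      by_cases hdU' : d' ∈ U
      · simp only [hU (leOfHom f) hdU', hdU', dite_true, l.naturality]
      obtain rfl := eq_x hd' hdU'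
      by_cases hdU : d ∈ U
      · simpa [hdU, hdU'] using hm d f (lt_of_le_of_ne (leOfHom f) fun e ↦ hdU' (e ▸ hdU))
      · obtain rfl := eq_x hd hdU
        obtain rfl : f = 𝟙 _ := rfl
        simp
    fac_left := fun d hd ↦ by
      by_cases hdU : d ∈ U
      · simp only [hdU, dite_true, l.fac_left]
      · obtain rfl := eq_x hd hdU
        simp [hdU, hleft]
    fac_right := fun d hd ↦ by
      by_cases hdU : d ∈ U
      · simp only [hdU, dite_true, l.fac_right]
      · obtain rfl := eq_x hd hdU
        simp [hdU, hright] }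

end PartialLift

lemma hasLiftingProperty_of_mediating [Finite D] [HasFiniteColimits C]
    (h : ∀ x, HasLiftingProperty (mediating φ x) (p.app x)) : HasLiftingProperty φ p where
  sq_hasLift {a b} sq := by
    obtain ⟨l⟩ : Nonempty (PartialLift sq Set.univ) := by
      refine isLowerSet_induction (p := fun U ↦ Nonempty (PartialLift sq U))
        ⟨⟨nofun, nofun, nofun, nofun⟩⟩ ?_
      rintro U x hU - hx ⟨l⟩
      obtain ⟨m, hm, hleft, hright⟩ := l.exists_value hx
      exact ⟨l.insert hU hx m hm hleft hright⟩
    exact ⟨⟨{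
      l := { app := fun d ↦ l.app d (Set.mem_univ d), naturality := fun _ _ f ↦ l.naturality f _ _ }
      fac_left := by ext d; exact l.fac_left d _
      fac_right := by ext d; exact l.fac_right d _ }⟩⟩

end Lifting

section Factorization

variable {D : Type w} [PartialOrder D] [Finite D] {C : Type u} [Category.{v} C]
  [HasFiniteColimits C] {X W : D ⥤ C} {c : X ⟶ W}

open Classical in
/-- The diagram obtained from `W` by replacing its values with the middle objects of factorizations
of the mediating morphisms of `c : X ⟶ W`. -/
noncomputable abbrev replace (T : ∀ d, Factorisation (mediating c d)) : D ⥤ C where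
  obj d := (T d).mid
  map {d d'} f := if h : d = d' then eqToHom (by rw [h]) else
    (T d).π ≫ ιBelow W (lt_of_le_of_ne (leOfHom f) h) ≫ pushout.inl _ _ ≫ (T d').ι
  map_id d := by simp
  map_comp {d d' d''} f g := by
    obtain rfl | hlt := (leOfHom f).eq_or_lt
    · obtain rfl : f = 𝟙 _ := rfl
      simp
    obtain rfl | hlt' := (leOfHom g).eq_or_lt
    · obtain rfl : g = 𝟙 _ := rfl
      simp
    simp only [hlt.ne, hlt'.ne, (hlt.trans hlt').ne, dite_false, Category.assoc,
      Factorisation.ι_π_assoc, reassoc_of% inl_mediating, reassoc_of% ιBelow_colimBelowTo,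
      reassoc_of% map_ιBelow]

variable (T : ∀ d, Factorisation (mediating c d))

lemma replace_map_of_lt {d d' : D} (f : d ⟶ d') (h : d < d') :
    (replace T).map f = (T d).π ≫ ιBelow W h ≫ pushout.inl _ _ ≫ (T d').ι :=
  dif_neg h.ne

/-- The canonical morphism to the original diagram. -/
@[simps]
noncomputable def replaceTo : replace T ⟶ W where
  app d := (T d).π
  naturality d d' f := by
    obtain rfl | hlt := (leOfHom f).eq_or_lt
    · obtain rfl : f = 𝟙 _ := rfl
      simp
    · rw [replace_map_of_lt T f hlt]
      simp only [Category.assoc, Factorisation.ι_π, inl_mediating, ιBelow_colimBelowTo]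
      rfl

/-- The canonical morphism from the source of `c`. -/
@[simps]
noncomputable def toReplace : X ⟶ replace T where
  app d := pushout.inr _ _ ≫ (T d).ι
  naturality d d' f := by
    obtain rfl | hlt := (leOfHom f).eq_or_lt
    · obtain rfl : f = 𝟙 _ := rfl
      simp
    · obtain rfl : f = homOfLE hlt.le := rfl
      rw [replace_map_of_lt T _ hlt, ← ιBelow_colimBelowTo X hlt]
      simp only [Category.assoc, Factorisation.ι_π_assoc, reassoc_of% inr_mediating,
        ← pushout.condition_assoc, reassoc_of% ιBelow_colimBelowMap]

lemma toReplace_replaceTo : toReplace T ≫ replaceTo T = c := by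
  ext d
  simp [inr_mediating]

lemma mediating_toReplace (d : D) :
    mediating (toReplace T) d =
      latchMap ((Category.id_comp c).trans (toReplace_replaceTo T).symm) d ≫ (T d).ι := by
  refine latch_hom_ext (fun d' hd' ↦ ?_) ?_
  · rw [inl_mediating, ιBelow_colimBelowTo, replace_map_of_lt T _ hd', reassoc_of% inl_latchMap,
      reassoc_of% ιBelow_colimBelowMap]
    rfl
  · rw [inr_mediating, reassoc_of% inr_latchMap]
    exact (Category.id_comp _).symm

open Classical in
/-- The factorizations that are trivial except at `x`. -/
noncomputable def singleFactorisation {x : D} (t : Factorisation (mediating c x)) (d : D) :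
    Factorisation (mediating c d) :=
  Function.update (fun d ↦ (Factorisation.terminal : Factorisation (mediating c d))) x t d

lemma singleFactorisation_self {x : D} (t : Factorisation (mediating c x)) :
    singleFactorisation t x = t := by
  classical exact Function.update_self ..

lemma singleFactorisation_of_ne {x d : D} (t : Factorisation (mediating c x)) (h : d ≠ x) :
    singleFactorisation t d = Factorisation.terminal := by
  classical exact Function.update_of_ne h ..

lemma isIso_singleFactorisation_π {x d : D} (t : Factorisation (mediating c x)) (h : d ≠ x) :
    IsIso (singleFactorisation t d).π := by
  rw [singleFactorisation_of_ne t h]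
  exact inferInstanceAs (IsIso (𝟙 _))

variable {P : ∀ {A B E : C}, (A ⟶ B) → (B ⟶ E) → Prop}

lemma mediating_toReplace_singleFactorisation
    (hiso : ∀ {A' A B E : C} (e : A' ⟶ A) (i : A ⟶ B) (r : B ⟶ E), IsIso e → P i r → P (e ≫ i) r)
    {Y : D ⥤ C} (p : W ⟶ Y) {x d : D} (t : Factorisation (mediating c x)) (hd : ¬ x < d)
    (h : P (singleFactorisation t d).ι ((singleFactorisation t d).π ≫ p.app d)) :
    P (mediating (toReplace (singleFactorisation t)) d)
      ((replaceTo (singleFactorisation t) ≫ p).app d) := by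
  rw [mediating_toReplace]
  refine hiso _ _ _ (isIso_latchMap _ _ (fun _ _ ↦ inferInstanceAs (IsIso (𝟙 _))) ?_) h
  exact fun d' hd' ↦ isIso_singleFactorisation_π t fun e ↦ hd (e ▸ hd')

lemma exists_factorization_of_mediating
    (hP : ∀ {A E : C} (f : A ⟶ E), ∃ (B : C) (i : A ⟶ B) (r : B ⟶ E), i ≫ r = f ∧ P i r)
    (hiso : ∀ {A' A B E : C} (e : A' ⟶ A) (i : A ⟶ B) (r : B ⟶ E), IsIso e → P i r → P (e ≫ i) r)
    {X Y : D ⥤ C} (φ : X ⟶ Y) :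
    ∃ (W : D ⥤ C) (c : X ⟶ W) (p : W ⟶ Y), c ≫ p = φ ∧
      ∀ d, P (mediating c d) (p.app d) := by
  suffices H : ∃ (W : D ⥤ C) (c : X ⟶ W) (p : W ⟶ Y), c ≫ p = φ ∧
      (∀ d ∈ Set.univ, P (mediating c d) (p.app d)) ∧ (∀ d ∉ Set.univ, IsIso (p.app d)) by
    obtain ⟨W, c, p, fac, h, -⟩ := H
    exact ⟨W, c, p, fac, fun d ↦ h d (Set.mem_univ d)⟩
  refine isLowerSet_induction (p := fun U : Set D ↦ ∃ (W : D ⥤ C) (c : X ⟶ W) (p : W ⟶ Y),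
    c ≫ p = φ ∧ (∀ d ∈ U, P (mediating c d) (p.app d)) ∧ (∀ d ∉ U, IsIso (p.app d))) ?_ ?_
  · exact ⟨Y, φ, 𝟙 Y, Category.comp_id φ, nofun, fun d _ ↦ inferInstanceAs (IsIso (𝟙 _))⟩
  rintro U x hU hxU - ⟨W, c, p, rfl, hPU, hpU⟩
  have := hpU x hxU
  obtain ⟨B, i, r, fac, hir⟩ := hP (mediating c x ≫ p.app x)
  let t : Factorisation (mediating c x) := ⟨B, i, r ≫ inv (p.app x), by simp [reassoc_of% fac]⟩
  refine ⟨replace (singleFactorisation t), toReplace _, replaceTo _ ≫ p,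
    by rw [reassoc_of% toReplace_replaceTo], ?_, fun d hd ↦ ?_⟩
  · rintro d (rfl | hdU)
    · refine mediating_toReplace_singleFactorisation hiso p t (lt_irrefl _) ?_
      rw [singleFactorisation_self]
      simpa [t] using hir
    · refine mediating_toReplace_singleFactorisation hiso p t (fun h ↦ hxU (hU h.le hdU)) ?_
      rw [singleFactorisation_of_ne t fun h ↦ hxU (h ▸ hdU)]
      exact (Category.id_comp (p.app d)).symm ▸ hPU d hdU
  · have := hpU d fun h ↦ hd (Or.inr h)
    have := isIso_singleFactorisation_π t fun h ↦ hd (Or.inl h)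
    rw [NatTrans.comp_app, replaceTo_app]
    infer_instance

end Factorization

section Minimality

section General

variable {C : Type u} [Category.{v} C]

lemma IsMinimalFactorization.iso_comp {X X' W Y : C} {c : X ⟶ W} {p : W ⟶ Y}
    (h : IsMinimalFactorization c p) (e : X' ⟶ X) [IsIso e] :
    IsMinimalFactorization (e ≫ c) p :=
  fun ψ hc hp ↦ h ψ ((cancel_epi e).1 (by simpa using hc)) hp

lemma IsMinimalFactorization.comp_iso {X W Y Y' : C} {c : X ⟶ W} {p : W ⟶ Y}
    (h : IsMinimalFactorization c p) (e : Y ⟶ Y') [IsIso e] :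
    IsMinimalFactorization c (p ≫ e) :=
  fun ψ hc hp ↦ h ψ hc ((cancel_mono e).1 (by simpa using hp))

lemma isMinimalFactorization_of_isThin [Quiver.IsThin C] {X W Y : C} (c : X ⟶ W) (p : W ⟶ Y) :
    IsMinimalFactorization c p := fun ψ _ _ ↦ by
  obtain rfl := Subsingleton.elim (𝟙 W) ψ
  infer_instance

/-- Every morphism has a minimal factorization as a morphism in `L` followed by one in `R`. This is
`MinimalCofibrantFactorizationAxiom` for arbitrary classes of morphisms. -/
def HasMinimalFactorizations (L R : MorphismProperty C) : Prop :=
  ∀ ⦃X Y : C⦄ (f : X ⟶ Y), ∃ (W : C) (c : X ⟶ W) (p : W ⟶ Y),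
    c ≫ p = f ∧ L c ∧ R p ∧ IsMinimalFactorization c p

lemma minimalCofibrantFactorizationAxiom_iff [ModelCategory C] :
    MinimalCofibrantFactorizationAxiom C ↔
      HasMinimalFactorizations (cofibrations C) (trivialFibrations C) := by
  simp only [MinimalCofibrantFactorizationAxiom, HasMinimalFactorizations,
    mem_trivialFibrations_iff, ← cofibration_iff, and_assoc]

lemma isMinimalFactorization_map_iff {E : Type*} [Category* E] (F : C ⥤ E) [F.Full] [F.Faithful]
    {X W Y : C} {c : X ⟶ W} {p : W ⟶ Y} :
    IsMinimalFactorization (F.map c) (F.map p) ↔ IsMinimalFactorization c p := by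
  refine ⟨fun h ψ hc hp ↦ ?_, fun h ψ hc hp ↦ ?_⟩
  · have := h (F.map ψ) (by rw [← F.map_comp, hc]) (by rw [← F.map_comp, hp])
    exact isIso_of_reflects_iso ψ F
  · obtain ⟨ψ, rfl⟩ := F.map_surjective ψ
    have := h ψ (F.map_injective (by rw [F.map_comp, hc]))
      (F.map_injective (by rw [F.map_comp, hp]))
    infer_instance

lemma IsMinimalFactorization.isIso {X W Y : C} {c : X ⟶ W} {p : W ⟶ Y}
    (h : IsMinimalFactorization c p) [HasLiftingProperty c p] {β : X ⟶ X} [IsIso β] {ψ : W ⟶ W}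
    (hc : c ≫ ψ = β ≫ c) (hp : ψ ≫ p = p) : IsIso ψ := by
  -- A lift `l` of `β⁻¹ ≫ c` and `p` makes both `ψ ≫ l` and `l ≫ ψ` endomorphisms of `(c, p)`.
  have sq : CommSq (inv β ≫ c) c p p := ⟨by
    rw [Category.assoc, IsIso.inv_comp_eq, ← reassoc_of% hc, hp]⟩
  have h₁ : IsIso (ψ ≫ sq.lift) := h _
    (by rw [reassoc_of% hc, sq.fac_left, IsIso.hom_inv_id_assoc])
    (by rw [Category.assoc, sq.fac_right, hp])
  have h₂ : IsIso (sq.lift ≫ ψ) := h _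
    (by rw [sq.fac_left_assoc, Category.assoc, hc, IsIso.inv_hom_id_assoc])
    (by rw [Category.assoc, hp, sq.fac_right])
  have : Mono ψ := mono_of_mono ψ sq.lift
  have : IsSplitEpi ψ := ⟨⟨⟨inv (sq.lift ≫ ψ) ≫ sq.lift, by simp⟩⟩⟩
  exact isIso_of_mono_of_isSplitEpi ψ

end General

variable {D : Type w} [PartialOrder D] [Finite D] {C : Type u} [Category.{v} C]
  [HasFiniteColimits C]

lemma isMinimalFactorization_of_mediating {X W Y : D ⥤ C} {c : X ⟶ W} {p : W ⟶ Y}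
    (hlift : ∀ x, HasLiftingProperty (mediating c x) (p.app x))
    (hmin : ∀ x, IsMinimalFactorization (mediating c x) (p.app x)) :
    IsMinimalFactorization c p := by
  intro ψ hc hp
  suffices ∀ x, IsIso (ψ.app x) from NatIso.isIso_of_isIso_app ψ
  intro x
  induction x using WellFoundedLT.induction with
  | ind x ih =>
    have w : 𝟙 X ≫ c = c ≫ ψ := by rw [Category.id_comp, hc]
    have := isIso_latchMap w x (fun _ _ ↦ inferInstanceAs (IsIso (𝟙 _))) ih
    have := hlift x
    exact (hmin x).isIso (latchMap_mediating w x).symm (NatTrans.congr_app hp x)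

end Minimality

section WeakFactorizationSystem

variable {C : Type u} [Category.{v} C] (L R : MorphismProperty C) [L.IsWeakFactorizationSystem R]

include R in
lemma isStableUnderRetracts_left : L.IsStableUnderRetracts := by
  rw [← MorphismProperty.llp_eq_of_wfs L R]
  infer_instance

include L in
lemma isStableUnderRetracts_right : R.IsStableUnderRetracts := by
  rw [← MorphismProperty.rlp_eq_of_wfs L R]
  infer_instance

variable {D : Type w} [PartialOrder D] [Finite D] [HasFiniteColimits C]

instance latching_functorCategory_isWeakFactorizationSystem :
    (latching L : MorphismProperty (D ⥤ C)).IsWeakFactorizationSystem (R.functorCategory D) := by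
  have := isStableUnderRetracts_left L R
  have := isStableUnderRetracts_right L R
  have : (latching L : MorphismProperty (D ⥤ C)).HasFactorization (R.functorCategory D) :=
    ⟨fun φ ↦ by
    obtain ⟨W, c, p, fac, h⟩ := exists_factorization_of_mediating (P := fun i p ↦ L i ∧ R p)
      (fun f ↦ let h := MorphismProperty.factorizationData L R f
        ⟨h.Z, h.i, h.p, h.fac, h.hi, h.hp⟩)
      (fun e i _ _ h ↦ ⟨(L.cancel_left_of_respectsIso e i).2 h.1, h.2⟩) φ
    exact ⟨⟨W, c, p, fac, fun d ↦ (h d).1, fun d ↦ (h d).2⟩⟩⟩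
  exact .mk' _ _ fun i p hi hp ↦ hasLiftingProperty_of_mediating fun x ↦
    MorphismProperty.hasLiftingProperty_of_wfs _ _ (hi x) (hp x)

variable {L R} in
lemma HasMinimalFactorizations.latching (h : HasMinimalFactorizations L R) :
    HasMinimalFactorizations (latching L : MorphismProperty (D ⥤ C)) (R.functorCategory D) := by
  intro X Y φ
  have := isStableUnderRetracts_left L R
  obtain ⟨W, c, p, fac, H⟩ := exists_factorization_of_mediating
    (P := fun i p ↦ L i ∧ R p ∧ IsMinimalFactorization i p) (fun f ↦ h f)
    (fun e i _ _ h ↦ ⟨(L.cancel_left_of_respectsIso e i).2 h.1, h.2.1, h.2.2.iso_comp e⟩) φ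
  exact ⟨W, c, p, fac, fun d ↦ (H d).1, fun d ↦ (H d).2.1, isMinimalFactorization_of_mediating
    (fun d ↦ MorphismProperty.hasLiftingProperty_of_wfs _ _ (H d).1 (H d).2.1)
    fun d ↦ (H d).2.2⟩

end WeakFactorizationSystem

section Discretization

variable {Q : Type w} [PartialOrder Q] {C : Type u} [Category.{v} C]

section General

variable {D : Type w} [PartialOrder D]

instance [Finite D] [HasFiniteColimits C] (α : D →o Q) (q : Q) :
    HasColimitsOfShape (CostructuredArrow α.monotone.functor q) C := by
  have : Finite (CostructuredArrow α.monotone.functor q) :=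
    Finite.of_injective (fun g ↦ g.left) fun ⟨_, ⟨⟨⟩⟩, _⟩ ⟨_, ⟨⟨⟩⟩, _⟩ h ↦ by
      obtain rfl := h
      exact congrArg _ (Subsingleton.elim (α := (_ : Q) ⟶ q) _ _)
  have : Fintype (CostructuredArrow α.monotone.functor q) := Fintype.ofFinite _
  have : Quiver.IsThin (CostructuredArrow α.monotone.functor q) := fun _ _ ↦
    ⟨fun _ _ ↦ CostructuredArrow.hom_ext _ _ (Subsingleton.elim _ _)⟩
  exact hasColimitsOfShape_of_hasFiniteColimits C _

lemma discretizes_iff_mem_essImage_lan [Finite D] [HasFiniteColimits C] (α : D →o Q)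
    (X : Q ⥤ C) : Discretizes α X ↔ (α.monotone.functor.lan (H := C)).essImage X := by
  refine ⟨fun ⟨Y, η, _⟩ ↦ ⟨Y, ⟨?_⟩⟩, fun ⟨Y, ⟨e⟩⟩ ↦ ⟨Y,
    α.monotone.functor.lanUnit.app Y ≫ Functor.whiskerLeft α.monotone.functor e.hom, ?_⟩⟩
  · exact Functor.leftKanExtensionUnique _ (α.monotone.functor.lanUnit.app Y) _ η
  · exact Functor.isLeftKanExtension_of_iso e (α.monotone.functor.lanUnit.app Y) _ rfl

end General

/-- The inclusion functor of a finite full subposet. -/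
abbrev incl (S : Finset Q) : {q : Q // q ∈ S} ⥤ Q := (finiteInclusion S).monotone.functor

instance (S : Finset Q) : (incl S).Full := ⟨fun f ↦ ⟨homOfLE (leOfHom f), rfl⟩⟩

instance (S : Finset Q) : (incl S).Faithful := ⟨fun _ ↦ Subsingleton.elim _ _⟩

/-- Restriction of functors to a finite full subposet. -/
abbrev restrict (S : Finset Q) : (Q ⥤ C) ⥤ ({q : Q // q ∈ S} ⥤ C) :=
  (Functor.whiskeringLeft _ _ C).obj (incl S)

variable [HasFiniteColimits C]

/-- Left Kan extension of functors from a finite full subposet. -/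
noncomputable abbrev extend (S : Finset Q) : ({q : Q // q ∈ S} ⥤ C) ⥤ (Q ⥤ C) := (incl S).lan

/-- Extension is left adjoint to restriction. -/
noncomputable abbrev extendAdj (S : Finset Q) :
    (extend S : ({q : Q // q ∈ S} ⥤ C) ⥤ _) ⊣ restrict S :=
  (incl S).lanAdjunction C

instance (S : Finset Q) : (extend S : ({q : Q // q ∈ S} ⥤ C) ⥤ _).IsLeftAdjoint :=
  (extendAdj S).isLeftAdjoint

instance (S : Finset Q) : (extend S : ({q : Q // q ∈ S} ⥤ C) ⥤ _).Full :=
  (extendAdj S).fullyFaithfulLOfIsIsoUnit.full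

instance (S : Finset Q) : (extend S : ({q : Q // q ∈ S} ⥤ C) ⥤ _).Faithful :=
  (extendAdj S).fullyFaithfulLOfIsIsoUnit.faithful

lemma discretizes_finiteInclusion_iff {S : Finset Q} {X : Q ⥤ C} :
    Discretizes (finiteInclusion S) X ↔ IsIso ((extendAdj S).counit.app X) :=
  (discretizes_iff_mem_essImage_lan _ X).trans
    (Adjunction.isIso_counit_app_iff_mem_essImage (extendAdj S)).symm

lemma discretizes_extend (S : Finset Q) (Y : {q : Q // q ∈ S} ⥤ C) :
    Discretizes (finiteInclusion S) ((extend S).obj Y) :=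
  (discretizes_iff_mem_essImage_lan _ _).2 ((extend S).obj_mem_essImage Y)

lemma Discretizes.of_forall_mem {D : Type w} [PartialOrder D] [Finite D] {α : D →o Q}
    {X : Q ⥤ C} (h : Discretizes α X) {S : Finset Q} (hS : ∀ d, α d ∈ S) :
    Discretizes (finiteInclusion S) X := by
  let β : D →o {q : Q // q ∈ S} := ⟨fun d ↦ ⟨α d, hS d⟩, fun _ _ h ↦ α.monotone h⟩
  rw [discretizes_iff_mem_essImage_lan] at h ⊢
  obtain ⟨Y, ⟨e⟩⟩ := h
  exact ⟨_, ⟨(((β.monotone.functor.lanAdjunction C).comp (extendAdj S)).leftAdjointUniq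
    (α.monotone.functor.lanAdjunction C)).app Y ≪≫ e⟩⟩

lemma Discretizes.mono {S T : Finset Q} {X : Q ⥤ C}
    (h : Discretizes (finiteInclusion S) X) (hST : S ⊆ T) :
    Discretizes (finiteInclusion T) X :=
  h.of_forall_mem fun d ↦ hST d.2

lemma isTame_iff (X : Q ⥤ C) :
    isTame Q C X ↔ ∃ S : Finset Q, Discretizes (finiteInclusion S) X :=
  ⟨fun ⟨_, _, _, α, h⟩ ↦ ⟨(Set.finite_range α).toFinset, h.of_forall_mem fun d ↦ by simp⟩,
    fun ⟨_, h⟩ ↦ ⟨_, _, inferInstance, _, h⟩⟩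

lemma exists_discretizes_of_finite {ι : Type*} [Finite ι] (X : ι → Q ⥤ C)
    (hX : ∀ i, isTame Q C (X i)) :
    ∃ S : Finset Q, ∀ i, Discretizes (finiteInclusion S) (X i) := by
  classical
  have : Fintype ι := Fintype.ofFinite ι
  choose S hS using fun i ↦ (isTame_iff _).1 (hX i)
  exact ⟨Finset.univ.biUnion S, fun i ↦
    (hS i).mono (Finset.subset_biUnion_of_mem S (Finset.mem_univ i))⟩

lemma discretizes_of_isColimit {S : Finset Q} {J : Type*} [Category* J]
    [HasColimitsOfShape J C] {F : J ⥤ Q ⥤ C} {c : Cocone F} (hc : IsColimit c)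
    (hF : ∀ j, Discretizes (finiteInclusion S) (F.obj j)) :
    Discretizes (finiteInclusion S) c.pt := by
  simp_rw [discretizes_finiteInclusion_iff] at hF ⊢
  have : IsIso (Functor.whiskerLeft F (extendAdj (C := C) S).counit) :=
    (NatTrans.isIso_iff_isIso_app _).2 hF
  exact isIso_app_coconePt_of_preservesColimit F (extendAdj S).counit c hc

lemma Discretizes.of_retract {S : Finset Q} {X Y : Q ⥤ C} (h : Retract X Y)
    (hY : Discretizes (finiteInclusion S) Y) :
    Discretizes (finiteInclusion S) X := by
  rw [discretizes_finiteInclusion_iff] at hY ⊢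
  exact (MorphismProperty.isomorphisms _).of_retract
    (NatTrans.retractArrowApp (extendAdj S).counit h) hY

lemma hasLiftingProperty_of_restrict {S : Finset Q} {X Y A B : Q ⥤ C} {φ : X ⟶ Y} {p : A ⟶ B}
    (hX : Discretizes (finiteInclusion S) X) (hY : Discretizes (finiteInclusion S) Y)
    (h : HasLiftingProperty ((restrict S).map φ) ((restrict S).map p)) :
    HasLiftingProperty φ p := by
  rw [discretizes_finiteInclusion_iff] at hX hY
  have := ((extendAdj S).hasLiftingProperty_iff _ p).2 h
  exact HasLiftingProperty.of_arrow_iso_left (Arrow.isoMk (asIso ((extendAdj S).counit.app X))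
    (asIso ((extendAdj S).counit.app Y)) ((extendAdj S).counit.naturality φ).symm) p

lemma exists_factorization_of_restrict {S : Finset Q} {X Y : Q ⥤ C} {φ : X ⟶ Y}
    (hX : Discretizes (finiteInclusion S) X) (hY : Discretizes (finiteInclusion S) Y)
    {W : {q : Q // q ∈ S} ⥤ C} {c : (restrict S).obj X ⟶ W} {p : W ⟶ (restrict S).obj Y}
    (fac : c ≫ p = (restrict S).map φ) :
    ∃ (W' : Q ⥤ C) (c' : X ⟶ W') (p' : W' ⟶ Y),
      Discretizes (finiteInclusion S) W' ∧ c' ≫ p' = φ ∧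
      Nonempty (Arrow.mk c ≅ Arrow.mk ((restrict S).map c')) ∧
      Nonempty (Arrow.mk p ≅ Arrow.mk ((restrict S).map p')) ∧
      (IsMinimalFactorization c p → IsMinimalFactorization c' p') := by
  rw [discretizes_finiteInclusion_iff] at hX hY
  refine ⟨(extend S).obj W, inv ((extendAdj S).counit.app X) ≫ (extend S).map c,
    (extend S).map p ≫ (extendAdj S).counit.app Y, discretizes_extend S W, ?_, ⟨?_⟩, ⟨?_⟩, ?_⟩
  · rw [Category.assoc, ← Functor.map_comp_assoc, fac, IsIso.inv_comp_eq]
    exact (extendAdj S).counit.naturality φ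
  · refine Arrow.isoMk (Iso.refl _) (asIso ((extendAdj S).unit.app W)) ?_
    have h : (restrict S).map (inv ((extendAdj S).counit.app X)) =
        (extendAdj S).unit.app ((restrict S).obj X) := by
      rw [Functor.map_inv, IsIso.inv_eq_of_inv_hom_id]
      exact (extendAdj S).right_triangle_components X
    rw [Iso.refl_hom, Category.id_comp]
    simp only [Arrow.mk_hom, Functor.map_comp, h]
    exact ((extendAdj S).unit.naturality c).symm
  · refine Arrow.isoMk (asIso ((extendAdj S).unit.app W)) (Iso.refl _) ?_
    rw [Iso.refl_hom, Category.comp_id]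
    exact (((extendAdj S).eq_unit_comp_map_iff _ p).2 rfl).symm
  · intro h
    exact (((isMinimalFactorization_map_iff (extend S)).2 h).iso_comp _).comp_iso _

end Discretization

section Pointwise

variable {Q D : Type w} [PartialOrder Q] [PartialOrder D] [Finite D] {C : Type u} [Category.{v} C]
  [HasFiniteColimits C] {α : D →o Q} {X : Q ⥤ C} {Y : D ⥤ C} (η : Y ⟶ α.monotone.functor ⋙ X)
  [X.IsLeftKanExtension η]

lemma hom_ext_of_isLeftKanExtension {q : Q} {Z : C} {f g : X.obj q ⟶ Z}
    (h : ∀ (d : D) (u : α d ⟶ q), η.app d ≫ X.map u ≫ f = η.app d ≫ X.map u ≫ g) : f = g :=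
  (Functor.isPointwiseLeftKanExtensionOfIsLeftKanExtension X η q).hom_ext fun d ↦
    (Category.assoc _ _ _).trans ((h d.left d.hom).trans (Category.assoc _ _ _).symm)

lemma exists_desc_of_isLeftKanExtension {q : Q} {Z : C} (k : ∀ d, α d ≤ q → (Y.obj d ⟶ Z))
    (hk : ∀ (d d' : D) (f : d ⟶ d') (hd : α d ≤ q) (hd' : α d' ≤ q),
      Y.map f ≫ k d' hd' = k d hd) :
    ∃ l : X.obj q ⟶ Z, ∀ (d : D) (u : α d ⟶ q), η.app d ≫ X.map u ≫ l = k d (leOfHom u) := by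
  let c : Cocone (CostructuredArrow.proj α.monotone.functor q ⋙ Y) :=
    { pt := Z
      ι :=
        { app := fun g ↦ k g.left (leOfHom g.hom)
          naturality := fun g g' f ↦
            (hk _ _ f.left (leOfHom g.hom) (leOfHom g'.hom)).trans (Category.comp_id _).symm } }
  let hX := Functor.isPointwiseLeftKanExtensionOfIsLeftKanExtension X η q
  exact ⟨hX.desc c, fun d u ↦ (Category.assoc _ _ _).symm.trans
    (hX.fac c (CostructuredArrow.mk (S := α.monotone.functor) u))⟩

end Pointwise

section Generation

variable {Q : Type w} [PartialOrder Q] {C : Type u} [Category.{v} C] [HasFiniteColimits C]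
  {S : Finset Q} {X : Q ⥤ C}

lemma Discretizes.isLeftKanExtension (h : Discretizes (finiteInclusion S) X) :
    X.IsLeftKanExtension (𝟙 (incl S ⋙ X)) := by
  rwa [discretizes_finiteInclusion_iff, Functor.isIso_lanAdjunction_counit_app_iff] at h

lemma Discretizes.hom_ext (h : Discretizes (finiteInclusion S) X) {q : Q} {Z : C}
    {f g : X.obj q ⟶ Z} (hfg : ∀ s ∈ S, ∀ u : s ⟶ q, X.map u ≫ f = X.map u ≫ g) : f = g := by
  have := h.isLeftKanExtension
  exact hom_ext_of_isLeftKanExtension (𝟙 (incl S ⋙ X)) fun d u ↦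
    congrArg (𝟙 _ ≫ ·) (hfg d.1 d.2 u)

lemma Discretizes.exists_desc (h : Discretizes (finiteInclusion S) X) {q : Q} {Z : C}
    (k : ∀ s ∈ S, s ≤ q → (X.obj s ⟶ Z))
    (hk : ∀ (s s' : Q) (f : s ⟶ s') (hs : s ∈ S) (hs' : s' ∈ S) (hsq : s ≤ q) (hsq' : s' ≤ q),
      X.map f ≫ k s' hs' hsq' = k s hs hsq) :
    ∃ l : X.obj q ⟶ Z, ∀ s (hs : s ∈ S) (u : s ⟶ q), X.map u ≫ l = k s hs (leOfHom u) := by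
  have := h.isLeftKanExtension
  obtain ⟨l, hl⟩ := exists_desc_of_isLeftKanExtension (𝟙 (incl S ⋙ X)) (q := q) (Z := Z)
    (fun d hd ↦ k d.1 d.2 hd) fun d d' f hd hd' ↦ hk d.1 d'.1 ((incl S).map f) d.2 d'.2 hd hd'
  exact ⟨l, fun s hs u ↦ (Category.id_comp _).symm.trans (hl ⟨s, hs⟩ u)⟩

end Generation

section Floors

variable {Q : Type w} [PartialOrder Q] {C : Type u} [Category.{v} C]

/-- Every element of `Q` above some element of `S` is above a greatest element of `S`. Equivalently,
the inclusion of `S` into `Q` admits a transfer. -/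
def HasFloors (S : Finset Q) : Prop :=
  ∀ q : Q, ((S : Set Q) ∩ Set.Iic q).Nonempty → ∃ m, IsGreatest ((S : Set Q) ∩ Set.Iic q) m

lemma AdmitsTransfer.hasFloors {D : Type w} [PartialOrder D] [Finite D] {α : D →o Q}
    (h : AdmitsTransfer α) : HasFloors (Set.finite_range α).toFinset := by
  obtain ⟨t, ht⟩ := h
  have ht' (d : D) (q : Q) : α d ≤ q ↔ (d : WithBot D) ≤ t q := by
    rw [← ht, OrderHom.withBotMap_coe, WithBot.map_coe, WithBot.coe_le_coe]
  simp only [HasFloors, Set.Finite.coe_toFinset]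
  rintro q ⟨_, ⟨d, rfl⟩, hdq⟩
  obtain ⟨e, he⟩ := WithBot.ne_bot_iff_exists.1
    (ne_bot_of_le_ne_bot WithBot.coe_ne_bot ((ht' d q).1 hdq))
  refine ⟨α e, ⟨⟨e, rfl⟩, (ht' e q).2 he.le⟩, ?_⟩
  rintro _ ⟨⟨d, rfl⟩, hdq⟩
  exact α.monotone (WithBot.coe_le_coe.1 (he ▸ (ht' d q).1 hdq))

/-- The value of `X` at `q` only depends on the elements of `S` below `q`, in the weak sense of
comparing different points of `Q` along morphisms, and is initial if there are none. -/
structure IsConstantAlong (S : Finset Q) (X : Q ⥤ C) : Prop where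
  isIso_map {q q' : Q} (f : q ⟶ q') (h : ∀ s ∈ S, s ≤ q' → s ≤ q) : IsIso (X.map f)
  nonempty_isInitial {q : Q} (h : ∀ s ∈ S, ¬ s ≤ q) : Nonempty (IsInitial (X.obj q))

lemma IsConstantAlong.mono {S T : Finset Q} {X : Q ⥤ C} (hX : IsConstantAlong S X)
    (hST : S ⊆ T) : IsConstantAlong T X :=
  ⟨fun f h ↦ hX.isIso_map f fun s hs ↦ h s (hST hs),
    fun h ↦ hX.nonempty_isInitial fun s hs ↦ h s (hST hs)⟩

lemma HasFloors.map_app_of_mem {S : Finset Q} (hS : HasFloors S) {X Y : Q ⥤ C}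
    (hX : IsConstantAlong S X) (hY : IsConstantAlong S Y) (R : MorphismProperty C)
    [R.RespectsIso] [R.ContainsIdentities] {p : X ⟶ Y} (hp : ∀ s ∈ S, R (p.app s)) :
    R.functorCategory Q p := by
  intro q
  by_cases hq : ((S : Set Q) ∩ Set.Iic q).Nonempty
  · obtain ⟨m, hm, hmax⟩ := hS q hq
    let f : m ⟶ q := homOfLE hm.2
    have := hX.isIso_map f fun s hs hsq ↦ hmax ⟨hs, hsq⟩
    have := hY.isIso_map f fun s hs hsq ↦ hmax ⟨hs, hsq⟩
    exact (R.arrow_mk_iso_iff (Arrow.isoMk (asIso (X.map f)) (asIso (Y.map f))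
      (p.naturality _))).1 (hp m hm.1)
  · have hq' : ∀ s ∈ S, ¬ s ≤ q := fun s hs hsq ↦ hq ⟨s, hs, hsq⟩
    obtain ⟨h⟩ := hX.nonempty_isInitial hq'
    obtain ⟨h'⟩ := hY.nonempty_isInitial hq'
    have : IsIso (p.app q) := ⟨h'.to _, h.hom_ext _ _, h'.hom_ext _ _⟩
    exact R.of_isIso _

variable [HasFiniteColimits C]

lemma Discretizes.isConstantAlong {S : Finset Q} {X : Q ⥤ C}
    (hX : Discretizes (finiteInclusion S) X) : IsConstantAlong S X where
  isIso_map {q q'} f h := by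
    obtain ⟨l, hl⟩ := hX.exists_desc (q := q')
      (fun s hs hsq' ↦ X.map (homOfLE (h s hs hsq'))) fun _ _ _ _ _ _ _ ↦ (X.map_comp _ _).symm
    refine ⟨l, hX.hom_ext fun s hs u ↦ ?_, hX.hom_ext fun s hs u ↦ ?_⟩
    · rw [← X.map_comp_assoc, hl s hs, Category.comp_id]
      rfl
    · rw [reassoc_of% hl s hs, ← X.map_comp, Category.comp_id]
      rfl
  nonempty_isInitial {q} h :=
    ⟨IsInitial.ofUniqueHom
      (fun _ ↦ (hX.exists_desc (fun s hs hsq ↦ (h s hs hsq).elim)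
        fun s _ _ hs _ hsq ↦ (h s hs hsq).elim).choose)
      fun _ _ ↦ hX.hom_ext fun s hs u ↦ (h s hs (leOfHom u)).elim⟩

lemma HasFloors.discretizes_of_isConstantAlong {S : Finset Q} (hS : HasFloors S) {X : Q ⥤ C}
    (h : IsConstantAlong S X) : Discretizes (finiteInclusion S) X := by
  rw [discretizes_finiteInclusion_iff, ← MorphismProperty.isomorphisms.iff,
    ← MorphismProperty.functorCategory_isomorphisms]
  refine hS.map_app_of_mem (discretizes_extend S _).isConstantAlong h _ fun s hs ↦ ?_
  have : IsIso ((restrict S).map ((extendAdj S).counit.app X)) := inferInstance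
  exact (NatTrans.isIso_iff_isIso_app _).1 this ⟨s, hs⟩

end Floors

section FreeFunctors

variable {Q : Type w} [PartialOrder Q]

/-- The elements of `T` with the discrete order. -/
def DiscretePoints (T : Finset Q) : Type w := {q : Q // q ∈ T}

instance (T : Finset Q) : PartialOrder (DiscretePoints T) where
  le := Eq
  le_refl _ := rfl
  le_trans _ _ _ := Eq.trans
  le_antisymm _ _ h _ := h

instance (T : Finset Q) : Finite (DiscretePoints T) := inferInstanceAs (Finite {q : Q // q ∈ T})

/-- The underlying map of `DiscretePoints T` to `Q`. -/
def DiscretePoints.val (T : Finset Q) : DiscretePoints T →o Q :=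
  ⟨Subtype.val, fun _ _ h ↦ (congrArg Subtype.val h).le⟩

variable {C : Type u} [Category.{v} C] [HasFiniteColimits C] (T : Finset Q) (A : C)

/-- The functor freely generated by one copy of `A` at every element of `T`. -/
noncomputable def freeFunctor : Q ⥤ C :=
  (DiscretePoints.val T).monotone.functor.lan.obj ((Functor.const _).obj A)

/-- The unit of `freeFunctor`. -/
noncomputable def freeFunctorUnit :
    (Functor.const _).obj A ⟶ (DiscretePoints.val T).monotone.functor ⋙ freeFunctor T A :=
  (DiscretePoints.val T).monotone.functor.lanUnit.app _

instance : (freeFunctor T A).IsLeftKanExtension (freeFunctorUnit T A) :=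
  inferInstanceAs ((Functor.lan _).obj _ |>.IsLeftKanExtension (Functor.lanUnit _ |>.app _))

lemma isTame_freeFunctor : isTame Q C (freeFunctor T A) :=
  ⟨_, _, inferInstance, _, _, freeFunctorUnit T A, inferInstance⟩

variable {T A}

/-- The inclusion of the copy of `A` at `t` into the value at `q`. -/
noncomputable def freeFunctorι {t q : Q} (ht : t ∈ T) (h : t ≤ q) : A ⟶ (freeFunctor T A).obj q :=
  (freeFunctorUnit T A).app ⟨t, ht⟩ ≫ (freeFunctor T A).map (homOfLE h)

lemma freeFunctorι_map {t q q' : Q} (ht : t ∈ T) (h : t ≤ q) (f : q ⟶ q') :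
    freeFunctorι ht h ≫ (freeFunctor T A).map f = freeFunctorι ht (h.trans (leOfHom f)) := by
  simp only [freeFunctorι, Category.assoc, ← Functor.map_comp]
  rfl

lemma freeFunctor_hom_ext {q : Q} {Z : C} {f g : (freeFunctor T A).obj q ⟶ Z}
    (h : ∀ (t : Q) (ht : t ∈ T) (htq : t ≤ q),
      freeFunctorι ht htq ≫ f = freeFunctorι ht htq ≫ g) : f = g :=
  hom_ext_of_isLeftKanExtension (freeFunctorUnit T A) fun d u ↦
    (Category.assoc _ _ _).symm.trans ((h d.1 d.2 (leOfHom u)).trans (Category.assoc _ _ _))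

lemma exists_freeFunctor_desc {q : Q} {Z : C} (k : ∀ t ∈ T, t ≤ q → (A ⟶ Z)) :
    ∃ l : (freeFunctor T A).obj q ⟶ Z, ∀ (t : Q) (ht : t ∈ T) (htq : t ≤ q),
      freeFunctorι ht htq ≫ l = k t ht htq := by
  obtain ⟨l, hl⟩ := exists_desc_of_isLeftKanExtension (freeFunctorUnit T A) (q := q) (Z := Z)
    (fun d hd ↦ k d.1 d.2 hd) fun d d' f hd hd' ↦ by
      obtain rfl : d = d' := leOfHom f
      exact Category.id_comp _
  exact ⟨l, fun t ht htq ↦ (Category.assoc _ _ _).trans (hl ⟨t, ht⟩ (homOfLE htq))⟩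

lemma subset_of_discretizes_freeFunctor {Z : C} {f g : A ⟶ Z} (hfg : f ≠ g) {S : Finset Q}
    (h : Discretizes (finiteInclusion S) (freeFunctor T A)) : T ⊆ S := by
  classical
  intro t ht
  by_contra htS
  obtain ⟨a, ha⟩ := exists_freeFunctor_desc (T := T) (q := t) fun _ _ _ ↦ f
  obtain ⟨b, hb⟩ := exists_freeFunctor_desc (T := T) (q := t) fun t' _ _ ↦ if t' = t then g else f
  -- `a` and `b` differ only on the copy of `A` at `t`, which does not occur below `t`.
  have hab : a = b := h.hom_ext fun s hs u ↦ freeFunctor_hom_ext fun t' ht' hs' ↦ by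
    have hne : t' ≠ t := fun e ↦ htS ((leOfHom u).antisymm (e ▸ hs') ▸ hs)
    rw [← Category.assoc, ← Category.assoc, freeFunctorι_map, ha, hb, if_neg hne]
  apply hfg
  rw [← ha t ht le_rfl, hab, hb, if_pos rfl]

lemma mem_of_discretizes_freeFunctor_of_isThin [Quiver.IsThin C] (hA : IsEmpty (IsInitial A))
    {S : Finset Q} (h : Discretizes (finiteInclusion S) (freeFunctor T A)) {t : Q}
    (ht : Minimal (· ∈ T) t) : t ∈ S := by
  by_contra htS
  have hom (Z : C) : Nonempty (A ⟶ Z) := by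
    obtain ⟨l, -⟩ := h.exists_desc (q := t) (Z := Z)
      (fun s hs hst ↦ (exists_freeFunctor_desc fun t' ht' ht's ↦ by
        have := ht.eq_of_le ht' (ht's.trans hst)
        exact (htS (hst.antisymm (this ▸ ht's) ▸ hs)).elim).choose)
      fun _ _ _ _ _ _ _ ↦ Subsingleton.elim _ _
    exact ⟨freeFunctorι ht.prop le_rfl ≫ l⟩
  exact hA.false (IsInitial.ofUniqueHom (fun Z ↦ (hom Z).some) fun _ _ ↦ Subsingleton.elim _ _)

end FreeFunctors

section FlooredGenerators

variable {Q : Type w} [PartialOrder Q] {C : Type u} [Category.{v} C]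

variable (Q C) in
/-- Every tame functor is discretized by a finite full subposet with floors. -/
def HasFlooredGenerators : Prop :=
  ∀ X : Q ⥤ C, isTame Q C X → ∃ S : Finset Q, HasFloors S ∧ Discretizes (finiteInclusion S) X

variable (Q) in
/-- Every finite subset is contained in a finite subset with floors. -/
def HasFlooredSupersets : Prop :=
  ∀ T : Finset Q, ∃ S : Finset Q, T ⊆ S ∧ HasFloors S

variable [HasFiniteColimits C]

lemma hasFlooredGenerators_of_admitsTransfer
    (h : ∀ X : Q ⥤ C, isTame Q C X →
      ∃ (D : Type w) (_ : PartialOrder D) (_ : Finite D) (α : D →o Q),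
        AdmitsTransfer α ∧ Discretizes α X) : HasFlooredGenerators Q C := fun X hX ↦ by
  obtain ⟨D, _, _, α, hα, hαX⟩ := h X hX
  exact ⟨_, hα.hasFloors, hαX.of_forall_mem fun d ↦ by simp⟩

lemma HasFlooredGenerators.hasFlooredSupersets_or_isThin (H : HasFlooredGenerators Q C) :
    HasFlooredSupersets Q ∨ Quiver.IsThin C := by
  by_contra! ⟨hQ, hC⟩
  obtain ⟨A, Z, f, g, hfg⟩ : ∃ (A Z : C) (f g : A ⟶ Z), f ≠ g := by
    by_contra! h
    exact hC fun A Z ↦ ⟨h A Z⟩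
  refine hQ fun T ↦ ?_
  obtain ⟨S, hS, h⟩ := H _ (isTame_freeFunctor T A)
  exact ⟨S, subset_of_discretizes_freeFunctor hfg h, hS⟩

lemma HasFlooredSupersets.exists_discretizes_of_finite (hQ : HasFlooredSupersets Q) {ι : Type*}
    [Finite ι] (X : ι → Q ⥤ C) (hX : ∀ i, isTame Q C (X i)) :
    ∃ S : Finset Q, HasFloors S ∧ ∀ i, Discretizes (finiteInclusion S) (X i) := by
  obtain ⟨S, hS⟩ := TameFunctors.exists_discretizes_of_finite X hX
  obtain ⟨S', hSS', hS'⟩ := hQ S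
  exact ⟨S', hS', fun i ↦ (hS i).mono hSS'⟩

/-- The set of common upper bounds of every finite subset other than `∅` is the upper closure of a
finite set. -/
def HasFiniteUpperBounds (Q : Type w) [PartialOrder Q] : Prop :=
  ∀ F : Finset Q, F.Nonempty → ∃ G : Finset Q, ∀ q, (∀ s ∈ F, s ≤ q) ↔ ∃ g ∈ G, g ≤ q

lemma HasFlooredGenerators.hasFiniteUpperBounds_of_isThin [Quiver.IsThin C]
    (H : HasFlooredGenerators Q C) {A : C} (hA : IsEmpty (IsInitial A)) :
    HasFiniteUpperBounds Q := by
  classical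
  intro F ⟨s₀, hs₀⟩
  let M := F.filter (Maximal (· ∈ F))
  have hM : ∀ s ∈ F, ∃ m ∈ M, s ≤ m := fun s hs ↦ by
    obtain ⟨m, hsm, hm⟩ := F.exists_le_maximal hs
    exact ⟨m, Finset.mem_filter.2 ⟨hm.prop, hm⟩, hsm⟩
  have hMF : ∀ {m}, m ∈ M → Maximal (· ∈ F) m := fun hm ↦ (Finset.mem_filter.1 hm).2
  obtain ⟨S, hS, h⟩ := H _ (isTame_freeFunctor M A)
  -- `M` is an antichain, so all of its elements are minimal in it.
  have hMS : M ⊆ S := fun m hm ↦ mem_of_discretizes_freeFunctor_of_isThin hA h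
    ⟨hm, fun m' hm' hle ↦ (hMF hm').2 (hMF hm).prop hle⟩
  refine ⟨S.filter fun g ↦ ∀ s ∈ F, s ≤ g, fun q ↦ ⟨fun hq ↦ ?_, fun ⟨g, hg, hgq⟩ s hs ↦
    ((Finset.mem_filter.1 hg).2 s hs).trans hgq⟩⟩
  have hMq : ∀ m ∈ M, m ≤ q := fun m hm ↦ hq m (hMF hm).prop
  obtain ⟨m₀, hm₀, -⟩ := hM s₀ hs₀
  obtain ⟨g, hg, hgreatest⟩ := hS q ⟨m₀, hMS hm₀, hMq m₀ hm₀⟩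
  refine ⟨g, Finset.mem_filter.2 ⟨hg.1, fun s hs ↦ ?_⟩, hg.2⟩
  obtain ⟨m, hm, hsm⟩ := hM s hs
  exact hsm.trans (hgreatest ⟨hMS hm, hMq m hm⟩)

end FlooredGenerators

section Thin

variable {Q : Type w} [PartialOrder Q] {C : Type u} [Category.{v} C] [Quiver.IsThin C]

lemma isIso_of_isThin {X Y : C} (f : X ⟶ Y) (g : Y ⟶ X) : IsIso f :=
  ⟨g, Subsingleton.elim _ _, Subsingleton.elim _ _⟩

lemma HasFiniteUpperBounds.exists_representatives (h : HasFiniteUpperBounds Q) (S : Finset Q) :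
    ∃ T : Finset Q, ∀ q, (∃ s ∈ S, s ≤ q) → ∃ t ∈ T, t ≤ q ∧ ∀ s ∈ S, s ≤ q → s ≤ t := by
  classical
  choose! G hG using h
  refine ⟨(S.powerset.filter (·.Nonempty)).biUnion G, fun q ⟨s, hs, hsq⟩ ↦ ?_⟩
  have hF : (S.filter (· ≤ q)).Nonempty := ⟨s, Finset.mem_filter.2 ⟨hs, hsq⟩⟩
  obtain ⟨g, hg, hgq⟩ := (hG _ hF q).1 fun s hs ↦ (Finset.mem_filter.1 hs).2
  exact ⟨g, Finset.mem_biUnion.2 ⟨_, Finset.mem_filter.2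
      ⟨Finset.mem_powerset.2 (Finset.filter_subset _ _), hF⟩, hg⟩, hgq,
    fun s hs hsq ↦ (hG _ hF g).2 ⟨g, hg, le_rfl⟩ s (Finset.mem_filter.2 ⟨hs, hsq⟩)⟩

lemma exists_objectwise_factorization_of_isThin (L R : MorphismProperty C)
    [L.IsWeakFactorizationSystem R] {S : Finset Q} {X Y : Q ⥤ C} (hX : IsConstantAlong S X)
    (hY : IsConstantAlong S Y) (φ : X ⟶ Y) :
    ∃ (W : Q ⥤ C) (c : X ⟶ W) (p : W ⟶ Y), IsConstantAlong S W ∧ c ≫ p = φ ∧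
      L.functorCategory Q c ∧ R.functorCategory Q p := by
  let fac (q : Q) := MorphismProperty.factorizationData L R (φ.app q)
  have hom {q q' : Q} (a : X.obj q ⟶ X.obj q') (b : Y.obj q ⟶ Y.obj q') :
      Nonempty ((fac q).Z ⟶ (fac q').Z) := by
    have := MorphismProperty.hasLiftingProperty_of_wfs _ _ (fac q).hi (fac q').hp
    have sq : CommSq (a ≫ (fac q').i) (fac q).i (fac q').p ((fac q).p ≫ b) :=
      ⟨Subsingleton.elim _ _⟩
    exact ⟨sq.lift⟩
  let W : Q ⥤ C :=
    { obj := fun q ↦ (fac q).Z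
      map := fun f ↦ (hom (X.map f) (Y.map f)).some
      map_id := fun _ ↦ Subsingleton.elim _ _
      map_comp := fun _ _ ↦ Subsingleton.elim _ _ }
  refine ⟨W, { app := fun q ↦ (fac q).i, naturality := fun _ _ _ ↦ Subsingleton.elim _ _ },
    { app := fun q ↦ (fac q).p, naturality := fun _ _ _ ↦ Subsingleton.elim _ _ },
    ⟨fun f h ↦ ?_, fun {q} h ↦ ?_⟩,
    by ext; exact Subsingleton.elim _ _, fun q ↦ (fac q).hi, fun q ↦ (fac q).hp⟩
  · have := hX.isIso_map f h
    have := hY.isIso_map f h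
    exact isIso_of_isThin _ (hom (inv (X.map f)) (inv (Y.map f))).some
  · obtain ⟨h'⟩ := hY.nonempty_isInitial h
    exact ⟨IsInitial.ofUniqueHom (fun Z ↦ (fac q).p ≫ h'.to Z) fun _ _ ↦ Subsingleton.elim _ _⟩

variable [HasFiniteColimits C]

lemma IsConstantAlong.discretizes_of_isThin {S T : Finset Q} {X : Q ⥤ C}
    (hX : IsConstantAlong S X)
    (hT : ∀ q, (∃ s ∈ S, s ≤ q) → ∃ t ∈ T, t ≤ q ∧ ∀ s ∈ S, s ≤ q → s ≤ t) :
    Discretizes (finiteInclusion T) X := by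
  rw [discretizes_finiteInclusion_iff, NatTrans.isIso_iff_isIso_app]
  intro q
  by_cases hq : ∃ s ∈ S, s ≤ q
  · obtain ⟨t, ht, htq, hmax⟩ := hT q hq
    have : IsIso ((restrict T).map ((extendAdj T).counit.app X)) := inferInstance
    have : IsIso (((extendAdj T).counit.app X).app t) :=
      (NatTrans.isIso_iff_isIso_app _).1 this ⟨t, ht⟩
    have := hX.isIso_map (homOfLE htq) hmax
    exact isIso_of_isThin _ (inv (X.map (homOfLE htq)) ≫ inv (((extendAdj T).counit.app X).app t) ≫
      ((extend T).obj ((restrict T).obj X)).map (homOfLE htq))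
  · push Not at hq
    obtain ⟨h⟩ := hX.nonempty_isInitial hq
    exact isIso_of_isThin _ (h.to _)

lemma latching_of_functorCategory {L : MorphismProperty C} (R : MorphismProperty C)
    [L.IsWeakFactorizationSystem R] {D : Type w} [PartialOrder D] [Finite D] :
    L.functorCategory D ≤ latching L := by
  rw [← (latching L).llp_eq_of_wfs (R.functorCategory D)]
  intro X Y φ hφ A B p hp
  refine ⟨fun {a b} sq ↦ ?_⟩
  have lift (x : D) : Nonempty (Y.obj x ⟶ A.obj x) := by
    have := MorphismProperty.hasLiftingProperty_of_wfs _ _ (hφ x) (hp x)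
    have sq' : CommSq (a.app x) (φ.app x) (p.app x) (b.app x) := ⟨Subsingleton.elim _ _⟩
    exact ⟨sq'.lift⟩
  exact ⟨⟨{
    l := { app := fun x ↦ (lift x).some, naturality := fun _ _ _ ↦ Subsingleton.elim _ _ }
    fac_left := by ext; exact Subsingleton.elim _ _
    fac_right := by ext; exact Subsingleton.elim _ _ }⟩⟩

end Thin

section ConstantAlong

variable {Q : Type w} [PartialOrder Q] {C : Type u} [Category.{v} C]

lemma isConstantAlong_of_isInitial {X : Q ⥤ C} (S : Finset Q)
    (hX : ∀ q, Nonempty (IsInitial (X.obj q))) : IsConstantAlong S X where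
  isIso_map {q q'} _ _ :=
    ⟨(hX q').some.to _, (hX q).some.hom_ext _ _, (hX q').some.hom_ext _ _⟩
  nonempty_isInitial {q} _ := hX q

variable [HasFiniteColimits C]

lemma HasFlooredGenerators.isTame_of_isConstantAlong (H : HasFlooredGenerators Q C)
    {S : Finset Q} {X : Q ⥤ C} (hX : IsConstantAlong S X) : isTame Q C X := by
  rw [isTame_iff]
  rcases H.hasFlooredSupersets_or_isThin with hQ | _
  · obtain ⟨T, hST, hT⟩ := hQ S
    exact ⟨T, hT.discretizes_of_isConstantAlong (hX.mono hST)⟩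
  by_cases hC : ∃ A : C, IsEmpty (IsInitial A)
  · obtain ⟨A, hA⟩ := hC
    obtain ⟨T, hT⟩ := (H.hasFiniteUpperBounds_of_isThin hA).exists_representatives S
    exact ⟨T, hX.discretizes_of_isThin hT⟩
  · push Not at hC
    exact ⟨∅, (isConstantAlong_of_isInitial ∅ fun q ↦ hC (X.obj q)).discretizes_of_isThin
      fun q ⟨s, hs, _⟩ ↦ (Finset.notMem_empty s hs).elim⟩

end ConstantAlong

section Closure

lemma nonempty_isInitial_of_isLimit {C : Type u} [Category.{v} C] [HasZeroObject C] {J : Type*}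
    [Category* J] {F : J ⥤ C} {c : Cone F} (hc : IsLimit c)
    (hF : ∀ j, Nonempty (IsInitial (F.obj j))) : Nonempty (IsInitial c.pt) := by
  obtain ⟨Z, hZ⟩ := HasZeroObject.zero (C := C)
  have hFZ (j : J) : IsZero (F.obj j) :=
    hZ.of_iso ((hF j).some.uniqueUpToIso hZ.isInitial)
  have e : Z ≅ c.pt :=
    { hom := hZ.to_ _
      inv := hZ.from_ _
      hom_inv_id := hZ.eq_of_src _ _
      inv_hom_id := hc.hom_ext fun j ↦ (hFZ j).eq_of_tgt _ _ }
  exact ⟨hZ.isInitial.ofIso e⟩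

variable {Q : Type w} [PartialOrder Q] {C : Type u} [Category.{v} C]

lemma isConstantAlong_of_isLimit {J : Type*} [Category* J] [HasLimitsOfShape J C]
    {F : J ⥤ Q ⥤ C} {c : Cone F} (hc : IsLimit c) {S : Finset Q}
    (hF : ∀ j, IsConstantAlong S (F.obj j))
    (hS : ∀ q : Q, (∀ s ∈ S, ¬ s ≤ q) → HasZeroObject C) : IsConstantAlong S c.pt := by
  have hc' (q : Q) := isLimitOfPreserves ((evaluation Q C).obj q) hc
  refine ⟨fun {q q'} f h ↦ ?_, fun {q} h ↦ ?_⟩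
  · let a := Functor.whiskerLeft F ((evaluation Q C).map f)
    have : IsIso a := (NatTrans.isIso_iff_isIso_app a).2 fun j ↦ (hF j).isIso_map f h
    have ha : ((hc' q).conePointsIsoOfNatIso (hc' q') (asIso a)).hom = c.pt.map f :=
      (hc' q').hom_ext fun j ↦ by
        rw [IsLimit.conePointsIsoOfNatIso_hom_comp]
        exact ((c.π.app j).naturality f).symm
    exact ha ▸ Iso.isIso_hom _
  · have := hS q h
    exact nonempty_isInitial_of_isLimit (hc' q) fun j ↦ (hF j).nonempty_isInitial h

variable [HasFiniteColimits C]

instance {J : Type w'} [SmallCategory J] [FinCategory J] :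
    (isTame Q C).IsClosedUnderColimitsOfShape J where
  colimitsOfShape_le := by
    rintro X ⟨h⟩
    obtain ⟨S, hS⟩ := exists_discretizes_of_finite h.diag.obj h.prop_diag_obj
    exact (isTame_iff X).2 ⟨S, discretizes_of_isColimit h.isColimit hS⟩

lemma HasFlooredGenerators.isClosedUnderLimitsOfShape (H : HasFlooredGenerators Q C)
    [HasFiniteLimits C] (h₀ : HasZeroObject C ∨ ∃ S : Finset Q, ∀ q : Q, ∃ s ∈ S, s ≤ q)
    (J : Type w') [SmallCategory J] [FinCategory J] :
    (isTame Q C).IsClosedUnderLimitsOfShape J where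
  limitsOfShape_le := by
    classical
    rintro X ⟨h⟩
    obtain ⟨S, hS⟩ := exists_discretizes_of_finite h.diag.obj h.prop_diag_obj
    obtain ⟨T, hT⟩ : ∃ T : Finset Q, ∀ q : Q, (∀ t ∈ T, ¬ t ≤ q) → HasZeroObject C := by
      obtain h₀ | ⟨T, hT⟩ := h₀
      · exact ⟨∅, fun _ _ ↦ h₀⟩
      · exact ⟨T, fun q hq ↦ by obtain ⟨t, ht, htq⟩ := hT q; exact (hq t ht htq).elim⟩
    refine H.isTame_of_isConstantAlong (S := S ∪ T) (isConstantAlong_of_isLimit h.isLimit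
      (fun j ↦ (hS j).isConstantAlong.mono Finset.subset_union_left) fun q hq ↦ hT q fun t ht ↦ ?_)
    exact hq t (Finset.mem_union_right S ht)

end Closure

section TameMorphisms

lemma eq_inf_of_isWeakFactorizationSystem {C : Type u} [Category.{v} C]
    {L L' R W : MorphismProperty C} [W.HasTwoOutOfThreeProperty]
    [L.IsWeakFactorizationSystem (R ⊓ W)] [L'.IsWeakFactorizationSystem R] (h : L' ≤ W) :
    L' = L ⊓ W := by
  refine le_antisymm (le_inf ?_ h) ?_
  · rw [← L'.llp_eq_of_wfs R, ← L.llp_eq_of_wfs (R ⊓ W)]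
    exact MorphismProperty.antitone_llp (inf_le_left : R ⊓ W ≤ R)
  · rintro X Y φ ⟨hφ, hφW⟩
    let f := MorphismProperty.factorizationData L' R φ
    have hp : W f.p := W.of_precomp f.i f.p (h _ f.hi) (by rwa [f.fac])
    have := MorphismProperty.hasLiftingProperty_of_wfs (W₂ := R ⊓ W) φ f.p hφ ⟨f.hp, hp⟩
    have := isStableUnderRetracts_left L' R
    exact L'.of_retract (RetractArrow.ofLeftLiftingProperty f.fac) f.hi

lemma hasLiftingProperty_of_map {C E : Type*} [Category* C] [Category* E] (F : C ⥤ E) [F.Full]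
    [F.Faithful] {X Y A B : C} {i : X ⟶ Y} {p : A ⟶ B}
    (h : HasLiftingProperty (F.map i) (F.map p)) : HasLiftingProperty i p where
  sq_hasLift sq := by
    have sq' := sq.map F
    obtain ⟨l, hl⟩ := F.map_surjective sq'.lift
    exact ⟨⟨l, F.map_injective (by rw [F.map_comp, hl, sq'.fac_left]),
      F.map_injective (by rw [F.map_comp, hl, sq'.fac_right])⟩⟩

variable {Q : Type w} [PartialOrder Q] {C : Type u} [Category.{v} C]

/-- The morphisms of tame functors which are objectwise in `R`. -/
def tameObjectwise (R : MorphismProperty C) : MorphismProperty (Tame Q C) :=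
  (R.functorCategory Q).inverseImage (isTame Q C).ι

instance (R : MorphismProperty C) [R.IsStableUnderRetracts] :
    (tameObjectwise R : MorphismProperty (Tame Q C)).IsStableUnderRetracts :=
  inferInstanceAs ((R.functorCategory Q).inverseImage (isTame Q C).ι).IsStableUnderRetracts

instance (R : MorphismProperty C) [R.HasTwoOutOfThreeProperty] :
    (tameObjectwise R : MorphismProperty (Tame Q C)).HasTwoOutOfThreeProperty where
  comp_mem _ _ hf hg x := R.comp_mem _ _ (hf x) (hg x)
  of_postcomp f g hg hfg x := R.of_postcomp (f.hom.app x) (g.hom.app x) (hg x) (hfg x)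
  of_precomp f g hf hfg x := R.of_precomp (f.hom.app x) (g.hom.app x) (hf x) (hfg x)

lemma tameObjectwise_inf (R₁ R₂ : MorphismProperty C) :
    (tameObjectwise (R₁ ⊓ R₂) : MorphismProperty (Tame Q C)) =
      tameObjectwise R₁ ⊓ tameObjectwise R₂ := by
  ext X Y φ
  exact forall_and

variable [HasFiniteColimits C]

/-- The morphisms of tame functors whose restriction to some finite full subposet discretizing
the source and the target has its mediating morphisms in `L`. -/
def tameLatching (L : MorphismProperty C) : MorphismProperty (Tame Q C) :=
  fun X Y φ ↦ ∃ S : Finset Q, Discretizes (finiteInclusion S) X.obj ∧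
    Discretizes (finiteInclusion S) Y.obj ∧ latching L ((restrict S).map φ.hom)

instance (L : MorphismProperty C) [L.IsStableUnderRetracts] :
    (tameLatching L : MorphismProperty (Tame Q C)).IsStableUnderRetracts where
  of_retract h := fun ⟨S, hX, hY, hS⟩ ↦
    ⟨S, .of_retract (h.left.map (isTame Q C).ι) hX, .of_retract (h.right.map (isTame Q C).ι) hY,
      (latching L).of_retract (h.map ((isTame Q C).ι ⋙ restrict S)) hS⟩

section Lifting

variable {L : MorphismProperty C} (R : MorphismProperty C) [L.IsWeakFactorizationSystem R]

lemma hasLiftingProperty_of_tameLatching {X Y : Tame Q C} {φ : X ⟶ Y} (hφ : tameLatching L φ)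
    {A B : Q ⥤ C} {p : A ⟶ B} (hp : R.functorCategory Q p) : HasLiftingProperty φ.hom p := by
  obtain ⟨S, hX, hY, h⟩ := hφ
  exact hasLiftingProperty_of_restrict hX hY
    (MorphismProperty.hasLiftingProperty_of_wfs (W₁ := latching L) (W₂ := R.functorCategory _)
      _ _ h fun s ↦ hp s.1)

include R in
lemma tameLatching_le_tameObjectwise [HasFiniteProducts C] :
    (tameLatching L : MorphismProperty (Tame Q C)) ≤ tameObjectwise L := by
  intro X Y φ hφ
  have (q q' : Q) : R.IsStableUnderProductsOfShape (q ⟶ q') := by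
    rw [← L.rlp_eq_of_wfs R]
    infer_instance
  have h := llp_functorCategory_le R φ.hom fun _ _ _ hp ↦ hasLiftingProperty_of_tameLatching R hφ hp
  rwa [L.llp_eq_of_wfs R] at h

end Lifting

section Factorization

variable {L R : MorphismProperty C} {X Y : Tame Q C} {φ : X ⟶ Y}

variable (L R) [L.IsWeakFactorizationSystem R]

lemma HasFlooredSupersets.exists_tame_factorization (hQ : HasFlooredSupersets Q) (φ : X ⟶ Y) :
    ∃ S : Finset Q, ∀ {W : {q : Q // q ∈ S} ⥤ C} {c : (restrict S).obj X.obj ⟶ W}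
      {p : W ⟶ (restrict S).obj Y.obj}, c ≫ p = (restrict S).map φ.hom → latching L c →
      R.functorCategory _ p → ∃ (W' : Tame Q C) (c' : X ⟶ W') (p' : W' ⟶ Y), c' ≫ p' = φ ∧
        tameLatching L c' ∧ tameObjectwise R p' ∧
        (IsMinimalFactorization c p → IsMinimalFactorization c' p') := by
  obtain ⟨S, hS, hXY⟩ := hQ.exists_discretizes_of_finite ![X.obj, Y.obj]
    (Fin.forall_fin_two.2 ⟨X.property, Y.property⟩)
  refine ⟨S, fun {W c p} fac hc hp ↦ ?_⟩
  obtain ⟨W', c', p', hW', fac', ⟨ec⟩, ⟨ep⟩, hmin⟩ :=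
    exists_factorization_of_restrict (hXY 0) (hXY 1) fac
  have := isStableUnderRetracts_left L R
  have := isStableUnderRetracts_right L R
  have : R.ContainsIdentities := by
    rw [← L.rlp_eq_of_wfs R]
    infer_instance
  refine ⟨⟨W', (isTame_iff W').2 ⟨S, hW'⟩⟩, ObjectProperty.homMk c', ObjectProperty.homMk p',
    ObjectProperty.hom_ext _ fac', ⟨S, hXY 0, hW', ((latching L).arrow_mk_iso_iff ec).1 hc⟩,
    ?_, fun h ↦ (isMinimalFactorization_map_iff (isTame Q C).ι).1 (hmin h)⟩
  have hp' := ((R.functorCategory _).arrow_mk_iso_iff ep).1 hp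
  exact hS.map_app_of_mem hW'.isConstantAlong (hXY 1).isConstantAlong R fun s hs ↦ hp' ⟨s, hs⟩

lemma HasFlooredGenerators.exists_tame_factorization_of_isThin [Quiver.IsThin C]
    (H : HasFlooredGenerators Q C) (φ : X ⟶ Y) :
    ∃ (W : Tame Q C) (c : X ⟶ W) (p : W ⟶ Y), c ≫ p = φ ∧ tameLatching L c ∧
      tameObjectwise R p := by
  obtain ⟨S, hS⟩ := exists_discretizes_of_finite ![X.obj, Y.obj]
    (Fin.forall_fin_two.2 ⟨X.property, Y.property⟩)
  obtain ⟨W, c, p, hW, fac, hc, hp⟩ := exists_objectwise_factorization_of_isThin L R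
    (hS 0).isConstantAlong (hS 1).isConstantAlong φ.hom
  let W' : Tame Q C := ⟨W, H.isTame_of_isConstantAlong hW⟩
  obtain ⟨T, hT⟩ := exists_discretizes_of_finite ![X.obj, W]
    (Fin.forall_fin_two.2 ⟨X.property, W'.property⟩)
  exact ⟨W', ObjectProperty.homMk c, ObjectProperty.homMk p, ObjectProperty.hom_ext _ fac,
    ⟨T, hT 0, hT 1, latching_of_functorCategory R _ fun t ↦ hc t.1⟩, hp⟩

lemma HasFlooredGenerators.tame_hasFactorization (H : HasFlooredGenerators Q C) :
    (tameLatching L : MorphismProperty (Tame Q C)).HasFactorization (tameObjectwise R) := by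
  refine ⟨fun {X Y} φ ↦ ?_⟩
  rcases H.hasFlooredSupersets_or_isThin with hQ | _
  · obtain ⟨S, hS⟩ := hQ.exists_tame_factorization L R φ
    let f := MorphismProperty.factorizationData (latching L) (R.functorCategory _)
      ((restrict S).map φ.hom)
    obtain ⟨W, c, p, fac, hc, hp, -⟩ := hS f.fac f.hi f.hp
    exact ⟨⟨W, c, p, fac, hc, hp⟩⟩
  · obtain ⟨W, c, p, fac, hc, hp⟩ := H.exists_tame_factorization_of_isThin L R φ
    exact ⟨⟨W, c, p, fac, hc, hp⟩⟩

lemma HasFlooredGenerators.tame_isWeakFactorizationSystem (H : HasFlooredGenerators Q C) :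
    (tameLatching L : MorphismProperty (Tame Q C)).IsWeakFactorizationSystem
      (tameObjectwise R) := by
  have := isStableUnderRetracts_left L R
  have := isStableUnderRetracts_right L R
  have := H.tame_hasFactorization L R
  exact .mk' _ _ fun i p hi hp ↦ hasLiftingProperty_of_map (isTame Q C).ι
    (hasLiftingProperty_of_tameLatching R hi hp)

variable {L R} in
lemma HasMinimalFactorizations.tame (h : HasMinimalFactorizations L R)
    (H : HasFlooredGenerators Q C) :
    HasMinimalFactorizations (tameLatching L : MorphismProperty (Tame Q C))
      (tameObjectwise R) := by
  intro X Y φ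
  rcases H.hasFlooredSupersets_or_isThin with hQ | _
  · obtain ⟨S, hS⟩ := hQ.exists_tame_factorization L R φ
    obtain ⟨W₀, c₀, p₀, fac₀, hc₀, hp₀, hmin₀⟩ := h.latching ((restrict S).map φ.hom)
    obtain ⟨W, c, p, fac, hc, hp, hmin⟩ := hS fac₀ hc₀ hp₀
    exact ⟨W, c, p, fac, hc, hp, hmin hmin₀⟩
  · obtain ⟨W, c, p, fac, hc, hp⟩ := H.exists_tame_factorization_of_isThin L R φ
    have : Quiver.IsThin (Tame Q C) := fun _ _ ↦
      ⟨fun _ _ ↦ ObjectProperty.hom_ext _ (Subsingleton.elim _ _)⟩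
    exact ⟨W, c, p, fac, hc, hp, isMinimalFactorization_of_isThin c p⟩

end Factorization

end TameMorphisms

section ModelStructure

variable {Q : Type w} [PartialOrder Q] {C : Type u} [Category.{v} C] [ModelCategory C]

lemma tameWeakEquivalences_eq :
    tameWeakEquivalences Q C = tameObjectwise (weakEquivalences C) := by
  ext X Y φ
  exact forall_congr' fun x ↦ weakEquivalence_iff _

lemma tameFibrations_eq : tameFibrations Q C = tameObjectwise (fibrations C) := by
  ext X Y φ
  exact forall_congr' fun x ↦ fibration_iff _

lemma tameCofibrations_eq : tameCofibrations Q C = tameLatching (cofibrations C) := by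
  ext X Y φ
  exact exists_congr fun S ↦ and_congr_right fun _ ↦ and_congr_right fun _ ↦
    forall_congr' fun x ↦ cofibration_iff _

lemma HasFlooredGenerators.tame_isWeakFactorizationSystem_cofibrations
    (H : HasFlooredGenerators Q C) :
    (tameLatching (cofibrations C) : MorphismProperty (Tame Q C)).IsWeakFactorizationSystem
      (tameObjectwise (fibrations C) ⊓ tameObjectwise (weakEquivalences C)) := by
  rw [← tameObjectwise_inf]
  exact H.tame_isWeakFactorizationSystem (cofibrations C) (trivialFibrations C)

lemma HasFlooredGenerators.tame_isWeakFactorizationSystem_fibrations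
    (H : HasFlooredGenerators Q C) :
    (tameLatching (cofibrations C) ⊓ tameObjectwise (weakEquivalences C) :
      MorphismProperty (Tame Q C)).IsWeakFactorizationSystem (tameObjectwise (fibrations C)) := by
  have := H.tame_isWeakFactorizationSystem_cofibrations
  have := H.tame_isWeakFactorizationSystem (trivialCofibrations C) (fibrations C)
  have hle : (tameLatching (trivialCofibrations C) : MorphismProperty (Tame Q C)) ≤
      tameObjectwise (weakEquivalences C) := fun _ _ _ h q ↦
    (tameLatching_le_tameObjectwise (fibrations C) _ h q).2
  rwa [← eq_inf_of_isWeakFactorizationSystem (R := tameObjectwise (fibrations C)) hle]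

/-- The model structure on tame functors with the objectwise weak equivalences and fibrations. -/
abbrev HasFlooredGenerators.tameModelCategory (H : HasFlooredGenerators Q C)
    [HasFiniteLimits (Tame Q C)] : ModelCategory (Tame Q C) :=
  let _ : CategoryWithWeakEquivalences (Tame Q C) := ⟨tameObjectwise (weakEquivalences C)⟩
  let _ : CategoryWithFibrations (Tame Q C) := ⟨tameObjectwise (fibrations C)⟩
  let _ : CategoryWithCofibrations (Tame Q C) := ⟨tameLatching (cofibrations C)⟩
  have : HasFiniteColimits (Tame Q C) := ⟨fun _ _ _ ↦ inferInstance⟩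
  have : (weakEquivalences (Tame Q C)).HasTwoOutOfThreeProperty :=
    inferInstanceAs (tameObjectwise (weakEquivalences C)).HasTwoOutOfThreeProperty
  have : (cofibrations (Tame Q C)).IsWeakFactorizationSystem (trivialFibrations (Tame Q C)) :=
    H.tame_isWeakFactorizationSystem_cofibrations
  have : (trivialCofibrations (Tame Q C)).IsWeakFactorizationSystem (fibrations (Tame Q C)) :=
    H.tame_isWeakFactorizationSystem_fibrations
  .mk' (Tame Q C)

lemma minimalCofibrantFactorizationAxiom_tame (h : MinimalCofibrantFactorizationAxiom C)
    (H : HasFlooredGenerators Q C) [HasFiniteLimits (Tame Q C)] :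
    @MinimalCofibrantFactorizationAxiom (Tame Q C) _ H.tameModelCategory := by
  rw [minimalCofibrantFactorizationAxiom_iff] at h
  refine (@minimalCofibrantFactorizationAxiom_iff _ _ H.tameModelCategory).2 ?_
  have h' := h.tame H
  rw [trivialFibrations, tameObjectwise_inf] at h'
  exact h'

end ModelStructure

end TameFunctors

theorem mainTheorem4 {Q : Type w} [PartialOrder Q]
    {C : Type u} [Category.{v} C] [ModelCategory C]
    (hdisc : ∀ X : Q ⥤ C, isTame Q C X →
      ∃ (D : Type w) (_ : PartialOrder D) (_ : Finite D) (α : D →o Q),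
        AdmitsTransfer α ∧ Discretizes α X)
    (hterm : HasZeroObject C ∨ ∃ S : Finset Q, ∀ q : Q, ∃ s ∈ S, s ≤ q) :
    ∃ M : ModelCategory (Tame Q C),
      M.categoryWithWeakEquivalences.weakEquivalences = tameWeakEquivalences Q C ∧
      M.categoryWithFibrations.fibrations = tameFibrations Q C ∧
      M.categoryWithCofibrations.cofibrations = tameCofibrations Q C ∧
      (MinimalCofibrantFactorizationAxiom C →
        @MinimalCofibrantFactorizationAxiom (Tame Q C) _ M) := by
  have H := hasFlooredGenerators_of_admitsTransfer hdisc
  have : HasFiniteLimits (Tame Q C) := ⟨fun J _ _ ↦ by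
    have := H.isClosedUnderLimitsOfShape hterm J
    infer_instance⟩
  exact ⟨H.tameModelCategory, tameWeakEquivalences_eq.symm, tameFibrations_eq.symm,
    tameCofibrations_eq.symm, fun h ↦ minimalCofibrantFactorizationAxiom_tame h H⟩
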